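/- **Setting.** Let $E$ be a locally compact Polish space and $\mu$ a Borel measure on $E$ that is finite on compact sets. Let $\mathcal N(E)$ be the set of Borel measures on $E$ that are finite on compact sets and have values in $\mathbb N\cup\{\infty\}$, with the $\sigma$-field generated by the maps $\xi\mapsto\xi(A)$, $A\subseteq E$ Borel. A simple point process on $E$ is a random element $X$ of $\mathcal N(E)$ with $X(\{x\})\in\{0,1\}$ for all $x\in E$ almost surely. A bounded positive operator $K$ on the complex space $L^2(E,\mu)$ is *locally trace-class* if for every compact $A\subseteq E$ the compression $K_A=\mathbf 1_A K\mathbf 1_A$ is trace class. Such a $K$ is given on compactly supported functions by a measurable, Hermitian, positive semidefinite, locally square-integrable kernel, $(Kf)(x)=\int K(x,y)f(y)\,d\mu(y)$, normalized on the diagonal so that $\int_A K(x,x)\,d\mu(x)=\operatorname{tr}K_A$ for all compact $A$. We say that $X$ has law $\mathbf P^K$ if $X$ is a simple point process such that, for every $n\ge1$, $(x_1,\dots,x_n)\mapsto\det[K(x_i,x_j)]_{i,j\le n}$ is an $n$-point intensity function of $X$ with respect to $\mu$, i.e. its $\mu^n$-integral over each Borel $S\subseteq E^n$ is the expected number of ordered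 $n$-tuples of distinct points of $X$ that lie in $S$. For a countable discrete set $F$ and an operator $Q$ on $\ell^2(F)=L^2(F,\text{counting measure})$, $\mathbf P^Q$ is defined in the same way, with kernel the matrix of $Q$. **Theorem.** Let $K$ be a locally trace-class positive contraction on $L^2(E,\mu)$, and let $(A_i)_{i\ge1}$ be a partition of $E$ into precompact Borel sets (possibly empty). Then there exist a countable set $F$, a partition $(B_i)_{i\ge1}$ of $F$ (into possibly empty sets) and a positive contraction $Q$ on $\ell^2(F)$ that is unitarily equivalent to $K$, such that the law $\mathbf P^Q$ exists and, whenever $X$ has law $\mathbf P^K$ and $Y$ has law $\mathbf P^Q$, the joint distribution of the counts $(X(A_i))_{i\ge1}$ equals the joint distribution of the counts $(Y(B_i))_{i\ge1}$. -/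

import Mathlib

open MeasureTheory
open scoped ENNReal ComplexOrder

noncomputable section

namespace DPP

/-- `IsPartition A`: the sets `A 0, A 1, …` (some of which may be empty) are pairwise disjoint
and cover the whole space. -/
def IsPartition {E : Type*} (A : ℕ → Set E) : Prop :=
  Pairwise (fun i j => Disjoint (A i) (A j)) ∧ (⋃ i, A i) = Set.univ

/-- A positive contraction on a complex Hilbert space. -/
def IsPositiveContraction {H : Type*} [NormedAddCommGroup H] [InnerProductSpace ℂ H]
    [CompleteSpace H] (T : H →L[ℂ] H) : Prop :=
  T.IsPositive ∧ ‖T‖ ≤ 1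

/-- The sum `∑ i, ⟨b i, T (b i)⟩ ∈ [0, ∞]` over an orthonormal basis `b`. For a positive operator
`T` it does not depend on `b`, and it is the trace of `T`. -/
def traceAlong {H ι : Type*} [NormedAddCommGroup H] [InnerProductSpace ℂ H] [CompleteSpace H]
    (b : HilbertBasis ι ℂ H) (T : H →L[ℂ] H) : ℝ≥0∞ :=
  ∑' i, ENNReal.ofReal (inner ℂ (b i) (T (b i))).re

/-- `T` is positive and of trace class. -/
def IsPositiveTraceClass {H : Type*} [NormedAddCommGroup H] [InnerProductSpace ℂ H]
    [CompleteSpace H] (T : H →L[ℂ] H) : Prop :=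
  T.IsPositive ∧ ∀ (w : Set H) (b : HilbertBasis w ℂ H), traceAlong b T ≠ ∞

section Operators

variable {E : Type*} [MeasurableSpace E]

/-- Multiplication by the indicator function of `A`, the orthogonal projection of `L²(E, μ)` onto
the subspace `L²(A, μ_A)` of functions that vanish outside `A`. -/
def restrictL (μ : Measure E) {A : Set E} (hA : MeasurableSet A) :
    Lp ℂ 2 μ →L[ℂ] Lp ℂ 2 μ :=
  LinearMap.mkContinuous
    { toFun := fun f => ((Lp.memLp f).indicator hA).toLp (A.indicator f)
      map_add' := fun f g => by
        rw [← MemLp.toLp_add]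
        apply MemLp.toLp_congr
        filter_upwards [Lp.coeFn_add f g] with x hx
        by_cases h : x ∈ A
        · simpa [h] using hx
        · simp [h]
      map_smul' := fun c f => by
        rw [RingHom.id_apply, ← MemLp.toLp_const_smul]
        apply MemLp.toLp_congr
        filter_upwards [Lp.coeFn_smul c f] with x hx
        by_cases h : x ∈ A
        · simpa [h] using hx
        · simp [h] }
    1 (fun f => by
      rw [one_mul]
      apply Lp.norm_le_norm_of_ae_le
      filter_upwards [((Lp.memLp f).indicator hA).coeFn_toLp] with x hx
      simp only [LinearMap.coe_mk, AddHom.coe_mk, hx]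
      exact norm_indicator_le_norm_self _ _)

/-- The compression `K_A` of `K` to `A`, as an operator on `L²(E, μ)` that vanishes on the
orthogonal complement of `L²(A, μ_A)`. -/
def compression (μ : Measure E) (K : Lp ℂ 2 μ →L[ℂ] Lp ℂ 2 μ) {A : Set E}
    (hA : MeasurableSet A) : Lp ℂ 2 μ →L[ℂ] Lp ℂ 2 μ :=
  restrictL μ hA ∘L K ∘L restrictL μ hA

/-- `K` is locally trace-class: its compression to every compact set is of trace class.
(A compact set is measurable under the hypotheses used below; the proof of measurability is
quantified here so that the definition needs no further assumption.) -/
def IsLocallyTraceClass [TopologicalSpace E] (μ : Measure E)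
    (K : Lp ℂ 2 μ →L[ℂ] Lp ℂ 2 μ) : Prop :=
  ∀ (A : Set E) (hA : MeasurableSet A), IsCompact A → IsPositiveTraceClass (compression μ K hA)

/-- `k : E² → ℂ` is a kernel of the (positive, locally trace-class) operator `K`.
The operator determines `k` off the diagonal up to `μ²`-null sets; the last field fixes, up to a
`μ`-null set, the values on the diagonal, in the usual way: they are such that the
integral of `k (x, x)` over every compact set is the trace of the compression. -/
structure IsKernel [TopologicalSpace E] (μ : Measure E) (K : Lp ℂ 2 μ →L[ℂ] Lp ℂ 2 μ)
    (k : E → E → ℂ) : Prop where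
  measurable : Measurable (Function.uncurry k)
  /-- The kernel is Hermitian and positive semidefinite. -/
  posSemidef : ∀ (n : ℕ) (x : Fin n → E), (Matrix.of fun i j => k (x i) (x j)).PosSemidef
  /-- The kernel is locally square integrable. -/
  sq_integrable : ∀ A : Set E, IsCompact A →
    IntegrableOn (fun p : E × E => ‖k p.1 p.2‖ ^ 2) (A ×ˢ A) (μ.prod μ)
  /-- `K` is the integral operator with kernel `k`, on compactly supported functions. -/
  apply_eq : ∀ A : Set E, IsCompact A → ∀ f : Lp ℂ 2 μ, (∀ᵐ x ∂μ, x ∉ A → f x = 0) →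
    ∀ᵐ x ∂μ, K f x = ∫ y, k x y * f y ∂μ
  diagonal : ∀ (A : Set E) (hA : MeasurableSet A), IsCompact A →
    ∀ (w : Set (Lp ℂ 2 μ)) (b : HilbertBasis w ℂ (Lp ℂ 2 μ)),
      ∫⁻ x in A, ENNReal.ofReal (k x x).re ∂μ = traceAlong b (compression μ K hA)

end Operators

section PointProcesses

variable (E : Type*) [TopologicalSpace E] [MeasurableSpace E]

/-- The space `𝒩(E)` of measures on `E` that are finite on compact sets and have values in
`ℕ ∪ {∞}`. It carries the σ-field generated by the maps `ξ ↦ ξ A`, for Borel `A`: this is the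
σ-field of Mathlib on `Measure E`, restricted to the subtype. -/
abbrev Config : Type _ :=
  {ξ : Measure E // IsFiniteMeasureOnCompacts ξ ∧
    ∀ A : Set E, MeasurableSet A → ∃ n : ℕ∞, ξ A = (n : ℝ≥0∞)}

variable {E}

/-- `ρ` is an `n`-point intensity function, with respect to `μ`, of the simple point process with
law `P`: for every Borel `S ⊆ Eⁿ`, the expected number of ordered `n`-tuples of distinct points
of the process that lie in `S` is `∫_S ρ dμⁿ`. -/
def IsIntensity (μ : Measure E) (P : Measure (Config E)) (n : ℕ)
    (ρ : (Fin n → E) → ℝ≥0∞) : Prop :=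
  ∀ S : Set (Fin n → E), MeasurableSet S →
    ∫⁻ ξ, Measure.pi (fun _ : Fin n => ξ.1) (S ∩ {x | Function.Injective x}) ∂P
      = ∫⁻ x in S, ρ x ∂(Measure.pi fun _ : Fin n => μ)

/-- `P` is the law of a simple point process that is determinantal with kernel `k` with respect
to the reference measure `μ`. -/
structure IsDeterminantalWith (μ : Measure E) (k : E → E → ℂ) (P : Measure (Config E)) :
    Prop where
  isProbabilityMeasure : IsProbabilityMeasure P
  simple : ∀ᵐ ξ ∂P, ∀ x : E, ξ.1 {x} = 0 ∨ ξ.1 {x} = 1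
  intensity : ∀ n : ℕ, 1 ≤ n → IsIntensity μ P n fun x =>
    ENNReal.ofReal (Matrix.det (Matrix.of fun i j => k (x i) (x j))).re

/-- `P` is the determinantal law `ℙ^K`, for an operator `K` on `L²(E, μ)`. -/
def IsDeterminantalLaw (μ : Measure E) (K : Lp ℂ 2 μ →L[ℂ] Lp ℂ 2 μ)
    (P : Measure (Config E)) : Prop :=
  ∃ k : E → E → ℂ, IsKernel μ K k ∧ IsDeterminantalWith μ k P

/-- The joint law, on `[0, ∞]^ℕ`, of the counts `X(A 0), X(A 1), …` when `X` has law `P`. -/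
def jointCountLaw (P : Measure (Config E)) (A : ℕ → Set E) : Measure (ℕ → ℝ≥0∞) :=
  P.map fun ξ i => ξ.1 (A i)

end PointProcesses

/-- The complex Hilbert space `ℓ²(F)`. -/
abbrev Ell2 (F : Type*) : Type _ := lp (fun _ : F => ℂ) 2

open Classical in
/-- The matrix `Q(x, y) = (Q 𝟙_y)(x)` of an operator `Q` on `ℓ²(F)`. -/
def matrixEntry {F : Type*} (Q : Ell2 F →L[ℂ] Ell2 F) (x y : F) : ℂ :=
  Q (lp.single 2 y (1 : ℂ)) x

/-- `P` is the determinantal law `ℙ^Q`, for an operator `Q` on `ℓ²(F)`, where `F` is a discrete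
space with the counting measure. The kernel is the matrix of `Q`. -/
def IsDiscreteDeterminantalLaw {F : Type*} [TopologicalSpace F] [MeasurableSpace F]
    (Q : Ell2 F →L[ℂ] Ell2 F) (P : Measure (Config F)) : Prop :=
  IsDeterminantalWith Measure.count (matrixEntry Q) P

end DPP

end

namespace DPP

open scoped Nat ComplexConjugate Matrix

/-! Choose a Hilbert basis `b` of L²(E, μ) each of whose vectors vanishes outside a single cell A_i
(`exists_adapted_hilbertBasis`). Let F be its index set, B_i the set of indices of vectors living in
A_i, and Q the matrix of K in this basis. The unitary given by `b` carries multiplication by 1_{A_i}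
to multiplication by 1_{B_i}, and the law of the counts depends only on K and these projections.

To see the latter, write K = R² with R self-adjoint. Almost everywhere, and also on the diagonal,
the kernel is ∑_j v_j(x) conj(v_j(y)) with v_j = R b_j (`IsKernel.isGram`); the matrix of Q has the
same form, with the coordinate sequences of the same vectors (`isGram_matrixEntry_transport`). For a
finite partial sum the Leibniz formula turns the integral of the n-point intensity over a product of
cells into a polynomial in the Gram numbers ∫_{A_i} v_j conj(v_l) = ⟨R b_l, 1_{A_i} R b_j⟩
(`lintegral_det_gramMatrix`), which agree on the two sides. Hadamard's inequality dominates the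
partial sums, so the full moments agree (`IsGram.tendsto_detMoment`).

Hadamard's inequality also bounds these factorial moments by products of constants attached to the
cells. Hence the generating function 𝔼 ∏ (1 + z_i)^{N_i} of finitely many counts is, for every z,
the sum of its factorial moment series (`hasSum_integral_counts`). At z_i = exp(iθ_i) - 1 it is the
characteristic function, so the moments determine the finite-dimensional laws of the counts
(`map_counts_eq`), and these determine the joint law.

Existence of ℙ^Q: on a finite set, the random subset equals S with probability the determinant whose
rows are those of Q on S and of 1 - Q off S. It is nonnegative by a Schur complement
(`det_mixedMatrix_nonneg`), and multilinearity gives the correct inclusion probabilities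
(`sum_det_mixedMatrix`). Compactness of the probability measures on {0,1}^F extends this to
countable F (`exists_determinantal_bool`). -/

/-! ### Hadamard's inequality. -/

/-- The eigenvalues are nonnegative and sum to the size of the matrix. Multiplying the bounds λ ≤
exp(λ - 1) gives exp 0 = 1. -/
theorem _root_.Matrix.PosSemidef.det_le_one_of_diag {n : Type*} [Fintype n] [DecidableEq n]
    {M : Matrix n n ℂ} (hM : M.PosSemidef) (hd : ∀ i, M i i = 1) : M.det.re ≤ 1 := by
  have htr : ∑ i, hM.1.eigenvalues i = Fintype.card n := by
    have h := hM.1.trace_eq_sum_eigenvalues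
    simp only [Matrix.trace, Matrix.diag, hd] at h
    have h' := congrArg Complex.re h
    simpa using h'.symm
  rw [hM.1.det_eq_prod_eigenvalues]
  have : (∏ i, (hM.1.eigenvalues i : ℂ)).re = ∏ i, hM.1.eigenvalues i := by
    rw [← Complex.ofReal_prod, Complex.ofReal_re]
  erw [this]
  calc ∏ i, hM.1.eigenvalues i ≤ ∏ i, Real.exp (hM.1.eigenvalues i - 1) :=
        Finset.prod_le_prod (fun i _ => hM.eigenvalues_nonneg i)
          (fun i _ => by linarith [Real.add_one_le_exp (hM.1.eigenvalues i - 1)])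
    _ = 1 := by
        rw [← Real.exp_sum, Finset.sum_sub_distrib, htr]
        simp

/-- **Hadamard's inequality** for matrices with positive diagonal. -/
theorem _root_.Matrix.PosSemidef.det_le_prod_diag_of_pos {n : Type*} [Fintype n] [DecidableEq n]
    {M : Matrix n n ℂ} (hM : M.PosSemidef) (hd : ∀ i, 0 < (M i i).re) :
    M.det.re ≤ ∏ i, (M i i).re := by
  -- Conjugation by the diagonal matrix with entries M_ii^{-1/2} makes the diagonal equal to 1 and
  -- divides the determinant by ∏ M_ii.
  let d : n → ℂ := fun i => ((Real.sqrt (M i i).re)⁻¹ : ℝ)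
  have hD : (Matrix.diagonal d)ᴴ = Matrix.diagonal d := by
    rw [Matrix.diagonal_conjTranspose]
    congr 1
    ext i
    simp [d]
  have hN := hM.conjTranspose_mul_mul_same (Matrix.diagonal d)
  rw [hD] at hN
  have him : ∀ i, M i i = ((M i i).re : ℂ) := fun i => by
    have := hM.diag_nonneg (i := i)
    exact Complex.ext rfl (by simpa using (Complex.le_def.1 this).2.symm)
  have h1 := hN.det_le_one_of_diag (fun i => by
    rw [Matrix.mul_diagonal, Matrix.diagonal_mul, him i]
    simp only [d]
    norm_cast
    have := Real.mul_self_sqrt (hd i).le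
    have h2 : Real.sqrt (M i i).re ≠ 0 := (Real.sqrt_pos.2 (hd i)).ne'
    field_simp
    rw [sq, this])
  rw [Matrix.det_mul, Matrix.det_mul, Matrix.det_diagonal] at h1
  have h3 : (∏ i, d i) = ((∏ i, (Real.sqrt (M i i).re)⁻¹ : ℝ) : ℂ) := by simp [d]
  rw [h3, mul_right_comm, ← Complex.ofReal_mul, Complex.re_ofReal_mul, ← Finset.prod_mul_distrib] at h1
  have h4 : ∀ i, (Real.sqrt (M i i).re)⁻¹ * (Real.sqrt (M i i).re)⁻¹ = ((M i i).re)⁻¹ := fun i => by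
    rw [← mul_inv, Real.mul_self_sqrt (hd i).le]
  simp_rw [h4] at h1
  rw [Finset.prod_inv_distrib, inv_mul_le_iff₀ (Finset.prod_pos fun i _ => hd i), mul_one] at h1
  exact h1

/-- Zeros on the diagonal are removed by adding ε to it; both sides are continuous as ε tends to 0.
-/
theorem _root_.Matrix.PosSemidef.det_le_prod_diag {n : Type*} [Fintype n] [DecidableEq n]
    {M : Matrix n n ℂ} (hM : M.PosSemidef) : M.det.re ≤ ∏ i, (M i i).re := by
  have key : ∀ ε : ℝ, 0 < ε →
      (M + (ε : ℂ) • (1 : Matrix n n ℂ)).det.re ≤ ∏ i, ((M + (ε : ℂ) • (1 : Matrix n n ℂ)) i i).re := by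
    intro ε hε
    have hP : (M + (ε : ℂ) • (1 : Matrix n n ℂ)).PosSemidef :=
      hM.add (Matrix.PosSemidef.one.smul (by exact_mod_cast hε.le))
    refine hP.det_le_prod_diag_of_pos fun i => ?_
    have := (Complex.le_def.1 (hM.diag_nonneg (i := i))).1
    simp at this ⊢
    linarith
  have hc : Continuous fun ε : ℝ => (M + (ε : ℂ) • (1 : Matrix n n ℂ)) := by fun_prop
  have h1 : Filter.Tendsto (fun ε : ℝ => (M + (ε : ℂ) • (1 : Matrix n n ℂ)).det.re)
      (nhdsWithin 0 (Set.Ioi 0)) (nhds M.det.re) := by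
    have : Continuous fun ε : ℝ => (M + (ε : ℂ) • (1 : Matrix n n ℂ)).det.re :=
      Complex.continuous_re.comp hc.matrix_det
    simpa using (this.tendsto 0).mono_left nhdsWithin_le_nhds
  have h2 : Filter.Tendsto (fun ε : ℝ => ∏ i, ((M + (ε : ℂ) • (1 : Matrix n n ℂ)) i i).re)
      (nhdsWithin 0 (Set.Ioi 0)) (nhds (∏ i, (M i i).re)) := by
    have : Continuous fun ε : ℝ => ∏ i, ((M + (ε : ℂ) • (1 : Matrix n n ℂ)) i i).re :=
      continuous_finsetProd _ fun i _ => Complex.continuous_re.comp (hc.matrix_elem i i)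
    simpa using (this.tendsto 0).mono_left nhdsWithin_le_nhds
  exact le_of_tendsto_of_tendsto h1 h2 (eventually_nhdsWithin_of_forall key)

/-! ### Determinantal random subsets of a countable set. -/

/-- The matrix whose rows in `T` are those of `Q`, the other rows being those of `1 - Q`. -/
def mixedMatrix {n : Type*} [Fintype n] [DecidableEq n] (Q : Matrix n n ℂ) (T : Finset n) :
    Matrix n n ℂ :=
  Matrix.of fun x y => if x ∈ T then Q x y else (1 - Q) x y

/-- The sign in the lower left block makes the Schur complement D + Bᴴ A⁻¹ B a sum of two positive
semidefinite matrices. -/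
theorem det_fromBlocks_nonneg_of_posDef {m n : Type*} [Fintype m] [DecidableEq m] [Fintype n]
    [DecidableEq n] {A : Matrix m m ℂ} {B : Matrix m n ℂ} {D : Matrix n n ℂ} (hA : A.PosDef)
    (hD : D.PosSemidef) : 0 ≤ (Matrix.fromBlocks A B (-Bᴴ) D).det := by
  have : Invertible A := hA.isUnit.invertible
  rw [Matrix.det_fromBlocks₁₁]
  refine mul_nonneg hA.det_pos.le (Matrix.PosSemidef.det_nonneg ?_)
  rw [Matrix.neg_mul, Matrix.neg_mul, sub_neg_eq_add, Matrix.invOf_eq_nonsing_inv]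
  exact hD.add (hA.inv.posSemidef.conjTranspose_mul_mul_same B)

theorem det_fromBlocks_nonneg {m n : Type*} [Fintype m] [DecidableEq m] [Fintype n]
    [DecidableEq n] {A : Matrix m m ℂ} {B : Matrix m n ℂ} {D : Matrix n n ℂ} (hA : A.PosSemidef)
    (hD : D.PosSemidef) : 0 ≤ (Matrix.fromBlocks A B (-Bᴴ) D).det := by
  have hc : Continuous fun ε : ℝ =>
      (Matrix.fromBlocks (A + (ε : ℂ) • (1 : Matrix m m ℂ)) B (-Bᴴ) D).det := by
    refine Continuous.matrix_det (Continuous.matrix_fromBlocks ?_ continuous_const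
      continuous_const continuous_const)
    fun_prop
  have h1 := (hc.tendsto 0).mono_left (nhdsWithin_le_nhds (s := Set.Ioi 0))
  simp only [Complex.ofReal_zero, zero_smul, add_zero] at h1
  refine ge_of_tendsto h1 (eventually_nhdsWithin_of_forall fun ε hε => ?_)
  refine det_fromBlocks_nonneg_of_posDef ?_ hD
  refine Matrix.PosDef.posSemidef_add hA (Matrix.PosDef.one.smul ?_)
  exact_mod_cast hε

/-- Off the diagonal 1 - Q equals -Q, so the two off-diagonal blocks are B and -Bᴴ. This determinant
will be the probability that the random subset is exactly `T`. -/
theorem det_mixedMatrix_nonneg {n : Type*} [Fintype n] [DecidableEq n] {Q : Matrix n n ℂ}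
    (hQ : Q.PosSemidef) (hQ' : (1 - Q).PosSemidef) (T : Finset n) :
    0 ≤ (mixedMatrix Q T).det := by
  rw [Matrix.det_toBlock _ (· ∈ T)]
  have h1 : (mixedMatrix Q T).toBlock (· ∈ T) (· ∈ T)
      = Q.submatrix (fun x : {x // x ∈ T} => x.1) (fun x : {x // x ∈ T} => x.1) := by
    ext x y
    simp [mixedMatrix, x.2]
  have h2 : (mixedMatrix Q T).toBlock (· ∉ T) (· ∉ T)
      = (1 - Q).submatrix (fun x : {x // x ∉ T} => x.1) (fun x : {x // x ∉ T} => x.1) := by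
    ext x y
    simp [mixedMatrix, x.2]
  have h3 : (mixedMatrix Q T).toBlock (· ∉ T) (· ∈ T) =
      -((mixedMatrix Q T).toBlock (· ∈ T) (· ∉ T))ᴴ := by
    ext x y
    have hne : x.1 ≠ y.1 := fun h => x.2 (h ▸ y.2)
    have := hQ.1.apply x.1 y.1
    simp [mixedMatrix, x.2, y.2, hne, ← this]
  rw [h3, h1, h2]
  convert det_fromBlocks_nonneg (B := (mixedMatrix Q T).toBlock (· ∈ T) (· ∉ T))
    (hQ.submatrix (fun x : {x // x ∈ T} => x.1)) (hQ'.submatrix (fun x : {x // x ∉ T} => x.1))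

/-- Outside `T`, each row of the identity is the row of Q plus the row of 1 - Q. Expanding the
determinant of `N` by multilinearity in these rows gives the sum over S ⊇ T, while `N` itself is
block triangular with an identity block. In probabilistic terms, the probabilities of the exact sets
S ⊇ T add up to the probability of containing T. -/
theorem sum_det_mixedMatrix {n : Type*} [Fintype n] [DecidableEq n] (Q : Matrix n n ℂ)
    (T : Finset n) :
    ∑ S ∈ Finset.univ.filter (T ⊆ ·), (mixedMatrix Q S).det
      = (Q.submatrix (fun x : {x // x ∈ T} => x.1) (fun x : {x // x ∈ T} => x.1)).det := by
  let r : n → n → ℂ := fun x y => Q x y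
  let r' : n → n → ℂ := fun x y => if x ∈ T then Q x y else (1 - Q) x y
  let N : Matrix n n ℂ := Matrix.of fun x y => if x ∈ T then Q x y else (1 : Matrix n n ℂ) x y
  have h := (Matrix.detRowAlternating (n := n) (R := ℂ)).toMultilinearMap.map_piecewise_add
    r r' Tᶜ
  have hL : Tᶜ.piecewise (r + r') r' = N := by
    ext x y
    simp only [Finset.piecewise, Finset.mem_compl, N, Matrix.of_apply]
    by_cases hx : x ∈ T <;> simp [hx, r, r']
  have h0 : (Matrix.detRowAlternating (n := n) (R := ℂ)).toMultilinearMap N = N.det := rfl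
  rw [hL, h0] at h
  have hdet : N.det
      = (Q.submatrix (fun x : {x // x ∈ T} => x.1) (fun x : {x // x ∈ T} => x.1)).det := by
    rw [Matrix.twoBlockTriangular_det _ (· ∈ T)]
    · have e1 : N.toSquareBlockProp (· ∉ T) = 1 := by
        ext x y
        simp [Matrix.toSquareBlockProp, x.2, Matrix.one_apply, Subtype.ext_iff, N]
      have e2 : N.toSquareBlockProp (· ∈ T)
          = Q.submatrix (fun x : {x // x ∈ T} => x.1) (fun x : {x // x ∈ T} => x.1) := by
        ext x y
        simp [Matrix.toSquareBlockProp, N]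
      rw [e1, e2, Matrix.det_one, mul_one]
      congr!
    · intro i hi j hj
      have : i ≠ j := fun h => hi (h ▸ hj)
      simp [hi, this, N]
  rw [← hdet, h]
  refine (Finset.sum_bij' (fun S _ => S ∪ T) (fun S _ => S \ T) ?_ ?_ ?_ ?_ ?_).symm
  · intro S _; simp
  · intro S _
    rw [Finset.mem_powerset]
    intro x
    simp
  · intro S hS
    rw [Finset.mem_powerset] at hS
    ext x
    have := @hS x
    simp at this ⊢
    tauto
  · intro S hS
    simp at hS
    simp [hS]
  · intro S hS
    have : S.piecewise r r' = mixedMatrix Q (S ∪ T) := by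
      ext x y
      simp only [Finset.piecewise]
      by_cases hx : x ∈ S <;> by_cases hx' : x ∈ T <;> simp [hx, hx', mixedMatrix, r, r']
    rw [this]; rfl

theorem exists_finite_determinantal {F : Type*} [DecidableEq F] (q : F → F → ℂ) (s : Finset F)
    (hq : (Matrix.of fun x y : s => q x y).PosSemidef)
    (hq' : ((1 : Matrix s s ℂ) - Matrix.of fun x y : s => q x y).PosSemidef) :
    ∃ ν : ProbabilityMeasure (F → Bool), ∀ T ⊆ s, (ν : Measure (F → Bool)) {ω | ∀ x ∈ T, ω x = true}
      = ENNReal.ofReal (Matrix.det (Matrix.of fun x y : T => q x y)).re := by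
  set M : Matrix s s ℂ := Matrix.of fun x y : s => q x y with hM
  let ν : Measure (F → Bool) := ∑ S : Finset s, ENNReal.ofReal (mixedMatrix M S).det.re •
    Measure.dirac (fun x => decide (∃ h : x ∈ s, (⟨x, h⟩ : s) ∈ S))
  have key : ∀ T ⊆ s, ν {ω | ∀ x ∈ T, ω x = true}
      = ENNReal.ofReal (Matrix.det (Matrix.of fun x y : T => q x y)).re := by
    intro T hT
    have hmeas : MeasurableSet {ω : F → Bool | ∀ x ∈ T, ω x = true} := by
      have : {ω : F → Bool | ∀ x ∈ T, ω x = true} = ⋂ x ∈ T, {ω | ω x = true} := by ext; simp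
      rw [this]
      exact Finset.measurableSet_biInter _ fun x _ =>
        measurableSet_eq_fun (measurable_pi_apply x) measurable_const
    let T' : Finset s := T.subtype (· ∈ s)
    have hT' : ∀ S : Finset s, (∀ x ∈ T, ∃ h : x ∈ s, (⟨x, h⟩ : s) ∈ S) ↔ T' ⊆ S := by
      intro S
      constructor
      · intro h x hx
        obtain ⟨_, h2⟩ := h x.1 (by simpa [T'] using hx)
        exact h2
      · intro h x hx
        exact ⟨hT hx, h (by simpa [T'] using hx)⟩
    let e : T ≃ {x // x ∈ T'} :=
      { toFun := fun x => ⟨⟨x.1, hT x.2⟩, by simp [T']⟩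
        invFun := fun x => ⟨x.1.1, Finset.mem_subtype.1 x.2⟩
        left_inv := fun x => rfl
        right_inv := fun x => rfl }
    have hdet : Matrix.det (Matrix.of fun x y : T => q x y)
        = (M.submatrix (fun x : {x // x ∈ T'} => x.1) (fun x : {x // x ∈ T'} => x.1)).det := by
      rw [← Matrix.det_submatrix_equiv_self e]
      rfl
    rw [hdet, ← sum_det_mixedMatrix, Complex.re_sum, ENNReal.ofReal_sum_of_nonneg
      fun S _ => (Complex.le_def.1 (det_mixedMatrix_nonneg hq hq' S)).1]
    simp only [ν, Measure.coe_finsetSum, Finset.sum_apply, Measure.smul_apply,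
      Measure.dirac_apply' _ hmeas, Set.indicator_apply, Set.mem_ofPred_eq, decide_eq_true_eq, hT',
      smul_eq_mul, Pi.one_apply, mul_ite, mul_one, mul_zero]
    rw [Finset.sum_filter]
  refine ⟨⟨ν, ⟨?_⟩⟩, key⟩
  -- The total mass is the case T = ∅, an empty determinant.
  have := key ∅ (Finset.empty_subset _)
  simpa using this

/-- A limit point of the finite-set measures exists because {0,1}^F is compact. The event of
containing a finite T is clopen, so its probability passes to the limit, and it is constant once the
finite set contains T. -/
theorem exists_determinantal_bool {F : Type*} [Countable F] [DecidableEq F] (q : F → F → ℂ)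
    (hq : ∀ s : Finset F, (Matrix.of fun x y : s => q x y).PosSemidef)
    (hq' : ∀ s : Finset F, ((1 : Matrix s s ℂ) - Matrix.of fun x y : s => q x y).PosSemidef) :
    ∃ ν : ProbabilityMeasure (F → Bool), ∀ T : Finset F,
      (ν : Measure (F → Bool)) {ω | ∀ x ∈ T, ω x = true}
      = ENNReal.ofReal (Matrix.det (Matrix.of fun x y : T => q x y)).re := by
  choose ν hν using fun s => exists_finite_determinantal q s (hq s) (hq' s)
  obtain ⟨ν', -, h'⟩ := isCompact_univ.ultrafilter_le_nhds
    ((Ultrafilter.of (Filter.atTop : Filter (Finset F))).map ν) (by simp)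
  refine ⟨ν', fun T => ?_⟩
  have hclopen : IsClopen {ω : F → Bool | ∀ x ∈ T, ω x = true} := by
    have : {ω : F → Bool | ∀ x ∈ T, ω x = true} = ⋂ x ∈ T, {ω | ω x = true} := by ext; simp
    rw [this]
    exact isClopen_biInter_finset fun x _ => (isClopen_discrete {true}).preimage (continuous_apply x)
  have ht : Filter.Tendsto ν (Ultrafilter.of (Filter.atTop : Filter (Finset F))) (nhds ν') := h'
  have h1 := ProbabilityMeasure.tendsto_measure_of_isClopen_of_tendsto ht hclopen
  have h2 : ∀ᶠ s in (Ultrafilter.of (Filter.atTop : Filter (Finset F)) : Filter (Finset F)),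
      ν s {ω : F → Bool | ∀ x ∈ T, ω x = true}
        = (ENNReal.ofReal (Matrix.det (Matrix.of fun x y : T => q x y)).re).toNNReal := by
    refine (Ultrafilter.of_le _) ?_
    filter_upwards [Filter.eventually_ge_atTop T] with s hs
    rw [← hν s T hs]
    rfl
  have h3 := tendsto_nhds_unique (h1.congr' h2) tendsto_const_nhds
  rw [← ProbabilityMeasure.ennreal_coeFn_eq_coeFn_toMeasure, h3]
  simp


/-! ### From random subsets to point processes on a discrete space. -/

instance sigmaFinite_config {E : Type*} [TopologicalSpace E] [SecondCountableTopology E]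
    [LocallyCompactSpace E] [MeasurableSpace E] (ξ : Config E) : SigmaFinite ξ.1 := by
  have := ξ.2.1
  infer_instance

theorem det_fin_eq_det_image {F : Type*} [DecidableEq F] (q : F → F → ℂ) {n : ℕ} {x : Fin n → F}
    (hx : Function.Injective x) :
    Matrix.det (Matrix.of fun i j => q (x i) (x j))
      = Matrix.det (Matrix.of fun y z : Finset.univ.image x => q y z) := by
  let e : Fin n ≃ Finset.univ.image x := Equiv.ofBijective
    (fun i => ⟨x i, Finset.mem_image_of_mem _ (Finset.mem_univ i)⟩)
    ⟨fun i j h => hx (congrArg Subtype.val h), fun y => by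
      obtain ⟨i, -, hi⟩ := Finset.mem_image.1 y.2
      exact ⟨i, Subtype.ext hi⟩⟩
  rw [← Matrix.det_submatrix_equiv_self e]
  rfl

section Discrete

variable {F : Type*} [Countable F] [TopologicalSpace F] [DiscreteTopology F] [MeasurableSpace F]
  [BorelSpace F]

/-- The counting measure of a subset of a countable discrete space, as a configuration. -/
noncomputable def boolConfig (ω : F → Bool) : Config F :=
  ⟨Measure.count.restrict {x | ω x = true}, ⟨fun s hs => by
    refine (Measure.restrict_apply_le _ _).trans_lt ?_
    exact Measure.count_apply_lt_top.2 hs.finite_of_discrete⟩, fun A hA => by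
    refine ⟨(A ∩ {x | ω x = true}).encard, ?_⟩
    rw [Measure.restrict_apply hA, Measure.count_apply (hA.inter (Set.to_countable _).measurableSet)]⟩

theorem boolConfig_singleton (ω : F → Bool) (x : F) :
    (boolConfig ω).1 {x} = if ω x = true then 1 else 0 := by
  rw [boolConfig, Measure.restrict_apply (measurableSet_singleton x)]
  split_ifs with h
  · rw [Set.inter_eq_left.2 (by simpa using h), Measure.count_singleton]
  · have : {x} ∩ {x | ω x = true} = ∅ := by
      ext y
      simp
      rintro rfl
      simpa using h
    rw [this, measure_empty]

theorem measurable_boolConfig : Measurable (boolConfig (F := F)) := by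
  refine Measurable.subtype_mk (Measure.measurable_of_measurable_coe _ fun A hA => ?_)
  have : ∀ ω : F → Bool, Measure.count.restrict {x | ω x = true} A
      = ∑' x, A.indicator (fun x => if ω x = true then (1 : ℝ≥0∞) else 0) x := by
    intro ω
    rw [← Measure.tsum_indicator_apply_singleton _ A hA]
    simp_rw [← boolConfig_singleton]
    rfl
  simp_rw [this]
  refine Measurable.tsum fun x => ?_
  by_cases hx : x ∈ A
  · simp only [Set.indicator_of_mem hx]
    exact Measurable.ite (measurableSet_eq_fun (measurable_pi_apply x) measurable_const)
      measurable_const measurable_const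
  · simp only [Set.indicator_of_notMem hx]
    exact measurable_const

theorem pi_config_apply (ξ : Config F) {n : ℕ} (S : Set (Fin n → F)) :
    Measure.pi (fun _ : Fin n => ξ.1) S
      = ∑' x, S.indicator (fun x : Fin n → F => ∏ a, ξ.1 {x a}) x := by
  rw [← Measure.tsum_indicator_apply_singleton _ S (Set.to_countable S).measurableSet]
  simp_rw [Measure.pi_singleton]

/-- Tuples are summed one at a time: an injective tuple contributes the probability that the random
subset contains its image. -/
theorem exists_isDeterminantalWith_count (q : F → F → ℂ)
    (hq : ∀ s : Finset F, (Matrix.of fun x y : s => q x y).PosSemidef)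
    (hq' : ∀ (s : Finset F) (_ : DecidableEq s),
      ((1 : Matrix s s ℂ) - Matrix.of fun x y : s => q x y).PosSemidef) :
    ∃ P : Measure (Config F), IsDeterminantalWith Measure.count q P := by
  classical
  obtain ⟨ν, hν⟩ := exists_determinantal_bool q hq fun s => hq' s _
  refine ⟨(ν : Measure (F → Bool)).map boolConfig,
    Measure.isProbabilityMeasure_map measurable_boolConfig.aemeasurable, ?_, ?_⟩
  · have hm : ∀ x : F, Measurable fun ξ : Config F => ξ.1 {x} := fun x =>
      (Measure.measurable_coe (measurableSet_singleton x)).comp measurable_subtype_coe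
    rw [ae_all_iff]
    intro x
    rw [ae_map_iff measurable_boolConfig.aemeasurable]
    · refine Filter.Eventually.of_forall fun ω => ?_
      rw [boolConfig_singleton]
      split_ifs <;> simp
    · exact (measurableSet_eq_fun (hm x) measurable_const).union
        (measurableSet_eq_fun (hm x) measurable_const)
  · intro n _ S hS
    have hm : ∀ x : Fin n → F, Measurable fun ξ : Config F =>
        (S ∩ {x | Function.Injective x}).indicator (fun x : Fin n → F => ∏ a, ξ.1 {x a}) x := by
      intro x
      by_cases hx : x ∈ S ∩ {x | Function.Injective x}
      · simp only [Set.indicator_of_mem hx]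
        exact Finset.measurable_prod _ fun a _ =>
          (Measure.measurable_coe (measurableSet_singleton _)).comp measurable_subtype_coe
      · simp only [Set.indicator_of_notMem hx]
        exact measurable_const
    have hm' : ∀ x : Fin n → F, AEMeasurable (fun ω => (S ∩ {x | Function.Injective x}).indicator
        (fun x : Fin n → F => ∏ a, (boolConfig ω).1 {x a}) x) (ν : Measure (F → Bool)) :=
      fun x => ((hm x).comp measurable_boolConfig).aemeasurable
    simp_rw [pi_config_apply]
    rw [lintegral_map (Measurable.tsum hm) measurable_boolConfig, lintegral_tsum hm',
      ← lintegral_indicator hS,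
      lintegral_countable']
    refine tsum_congr fun x => ?_
    rw [Measure.pi_singleton]
    simp only [Measure.count_singleton, Finset.prod_const_one, mul_one]
    by_cases hS : x ∈ S
    · by_cases hx : Function.Injective x
      · have hmem : x ∈ S ∩ {x | Function.Injective x} := ⟨hS, hx⟩
        simp only [Set.indicator_of_mem hmem, Set.indicator_of_mem hS]
        rw [det_fin_eq_det_image q hx, ← hν]
        have hset : MeasurableSet {ω : F → Bool | ∀ y ∈ Finset.univ.image x, ω y = true} := by
          have : {ω : F → Bool | ∀ y ∈ Finset.univ.image x, ω y = true}
              = ⋂ y ∈ Finset.univ.image x, {ω | ω y = true} := by ext; simp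
          rw [this]
          exact Finset.measurableSet_biInter _ fun y _ =>
            measurableSet_eq_fun (measurable_pi_apply y) measurable_const
        rw [← lintegral_indicator_one hset]
        refine lintegral_congr fun ω => ?_
        simp only [boolConfig_singleton]
        rw [Finset.prod_ite_zero]
        simp [Set.indicator_apply]
      · have hmem : x ∉ S ∩ {x | Function.Injective x} := fun h => hx h.2
        simp only [Set.indicator_of_notMem hmem, Set.indicator_of_mem hS]
        -- A repeated point produces two equal rows, so the intensity vanishes on tuples that are
        -- not injective.
        simp only [Function.Injective, not_forall] at hx
        obtain ⟨a, b, hab, hne⟩ := hx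
        rw [Matrix.det_zero_of_row_eq hne (by ext j; simp [hab])]
        simp
    · have hmem : x ∉ S ∩ {x | Function.Injective x} := fun h => hS h.1
      simp only [Set.indicator_of_notMem hmem, Set.indicator_of_notMem hS, lintegral_zero]

end Discrete

/-! ### Structure of simple configurations. -/

section Configurations

variable {E : Type*} [TopologicalSpace E] [SecondCountableTopology E] [T1Space E]
  [MeasurableSpace E] [BorelSpace E]

/-- A finite measure with values in `ℕ ∪ {∞}` and without atoms vanishes. -/
theorem eq_zero_of_integer_of_forall_singleton {η : Measure E} [IsFiniteMeasure η]
    (hint : ∀ A : Set E, MeasurableSet A → ∃ n : ℕ∞, η A = (n : ℝ≥0∞)) (h0 : ∀ x, η {x} = 0) :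
    η = 0 := by
  by_contra hη
  obtain ⟨x, hx⟩ := Measure.nonempty_support hη
  obtain ⟨U, hU, hUb⟩ := (nhds_basis_opens x).exists_antitone_subbasis
  -- Neighbourhoods of a point of the support have positive, hence by integrality at least unit,
  -- mass. Shrinking them to the point forces an atom there.
  have hone : ∀ i, 1 ≤ η (U i) := by
    intro i
    have hpos := (Measure.mem_support_iff_forall x).1 hx (U i) (hUb.mem i)
    obtain ⟨n, hn⟩ := hint (U i) (hU i).2.measurableSet
    rw [hn] at hpos ⊢
    have : n ≠ 0 := by rintro rfl; simp at hpos
    exact_mod_cast Order.one_le_iff_ne_zero.2 this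
  have hinter : ⋂ i, U i = {x} := by
    ext y
    simp only [Set.mem_iInter, Set.mem_singleton_iff]
    constructor
    · intro h
      by_contra hne
      obtain ⟨i, -, hi⟩ := hUb.toHasBasis.mem_iff.1
        (isOpen_compl_singleton.mem_nhds (Ne.symm hne) : {y}ᶜ ∈ nhds x)
      exact hi (h i) rfl
    · rintro rfl i
      exact (hU i).1
  have ht := tendsto_measure_iInter_atTop (μ := η) (s := U)
    (fun i => (hU i).2.measurableSet.nullMeasurableSet) hUb.antitone ⟨0, measure_ne_top _ _⟩
  rw [hinter, h0] at ht
  have := ge_of_tendsto' ht hone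
  simp at this

/-- A simple configuration is, on a set of finite mass, the counting measure of a finite set. -/
theorem exists_finset_restrict_eq_sum_dirac {ξ : Measure E}
    (hint : ∀ A : Set E, MeasurableSet A → ∃ n : ℕ∞, ξ A = (n : ℝ≥0∞))
    (hs : ∀ x, ξ {x} = 0 ∨ ξ {x} = 1) {D : Set E} (hD : MeasurableSet D) (hfin : ξ D ≠ ∞) :
    ∃ S : Finset E, ξ.restrict D = ∑ x ∈ S, Measure.dirac x := by
  classical
  -- Infinitely many unit atoms in `D` would give it more than any finite mass.
  have hSfin : {x | x ∈ D ∧ ξ {x} = 1}.Finite := by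
    by_contra hinf
    obtain ⟨n, hn⟩ := ENNReal.exists_nat_gt hfin
    obtain ⟨t, ht, htn⟩ := Set.Infinite.exists_subset_card_eq hinf n
    have h1 : ξ (t : Set E) = n := by
      rw [← sum_measure_singleton, Finset.sum_congr rfl fun x hx => (ht hx).2]
      simp [htn]
    have h2 : ξ (t : Set E) ≤ ξ D := measure_mono fun x hx => (ht hx).1
    exact absurd hn (not_lt.2 (h1 ▸ h2))
  let S := hSfin.toFinset
  have hS : ∀ x, x ∈ S ↔ x ∈ D ∧ ξ {x} = 1 := fun x => by simp [S]
  refine ⟨S, ?_⟩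
  -- Once the atoms are removed, a finite integer-valued measure without atoms remains.
  have hη : ξ.restrict (D \ S) = 0 := by
    have hDS : MeasurableSet (D \ (S : Set E)) := hD.diff S.measurableSet
    have : IsFiniteMeasure (ξ.restrict (D \ S)) :=
      ⟨by rw [Measure.restrict_apply_univ]; exact (measure_mono Set.sdiff_subset).trans_lt hfin.lt_top⟩
    refine eq_zero_of_integer_of_forall_singleton (fun A hA => ?_) fun x => ?_
    · rw [Measure.restrict_apply hA]
      exact hint _ (hA.inter hDS)
    · rw [Measure.restrict_apply (measurableSet_singleton x)]
      by_cases hx : x ∈ D \ (S : Set E)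
      · rw [Set.inter_eq_left.2 (by simpa using hx)]
        refine (hs x).resolve_right fun h => hx.2 ?_
        exact (hS x).2 ⟨hx.1, h⟩
      · rw [Set.singleton_inter_eq_empty.2 hx, measure_empty]
  ext A hA
  have hsplit : ξ.restrict D A = ξ (A ∩ D ∩ S) + ξ ((A ∩ D) \ S) := by
    rw [Measure.restrict_apply hA, measure_inter_add_sdiff _ S.measurableSet]
  have hz : ξ ((A ∩ D) \ S) = 0 := by
    have := congrArg (fun m : Measure E => m A) hη
    simp only [Measure.restrict_apply hA, Measure.coe_zero, Pi.zero_apply] at this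
    rwa [Set.inter_sdiff_assoc]
  have hset : A ∩ D ∩ S = (S.filter (· ∈ A) : Finset E) := by
    ext x
    have := hS x
    simp
    tauto
  rw [hsplit, hz, add_zero, hset, ← sum_measure_singleton, Finset.sum_filter,
    Measure.coe_finsetSum, Finset.sum_apply]
  refine Finset.sum_congr rfl fun x hx => ?_
  rw [Measure.dirac_apply' _ hA, Set.indicator_apply, ((hS x).1 hx).2]
  rfl

end Configurations

/-! ### Generating functions of counts as series over tuples of distinct points. -/

theorem pi_sum_dirac {E : Type*} [MeasurableSpace E] (S : Finset E) (n : ℕ) :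
    Measure.pi (fun _ : Fin n => ∑ x ∈ S, Measure.dirac x)
      = ∑ f ∈ Fintype.piFinset (fun _ : Fin n => S), Measure.dirac f := by
  classical
  refine Measure.pi_eq fun s hs => ?_
  simp only [Measure.coe_finsetSum, Finset.sum_apply]
  rw [Finset.prod_univ_sum]
  refine Finset.sum_congr rfl fun f _ => ?_
  rw [Measure.dirac_apply' _ (MeasurableSet.univ_pi hs)]
  simp_rw [fun a => Measure.dirac_apply' (f a) (hs a), Set.indicator_apply]
  rw [Finset.prod_ite_zero]
  simp

theorem card_filter_injective_image_eq {α : Type*} [DecidableEq α] {S t : Finset α} (hS : t ⊆ S) {n : ℕ}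
    (ht : t.card = n) :
    (((Fintype.piFinset fun _ : Fin n => S).filter Function.Injective).filter
      fun f => Finset.univ.image f = t).card = n ! := by
  have h : Fintype.card (Fin n ↪ t) = n ! := by
    rw [Fintype.card_embedding_eq]
    simp [ht, Nat.descFactorial_self]
  rw [← h, ← Finset.card_univ]
  refine (Finset.card_bij (fun f _ a => (f a : α)) ?_ ?_ ?_).symm
  · intro f _
    have hinj : Function.Injective fun a => (f a : α) := Subtype.val_injective.comp f.injective
    simp only [Finset.mem_filter, Fintype.mem_piFinset]
    refine ⟨⟨fun a => hS (f a).2, hinj⟩, ?_⟩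
    refine Finset.eq_of_subset_of_card_le (fun x hx => ?_) ?_
    · obtain ⟨a, -, rfl⟩ := Finset.mem_image.1 hx
      exact (f a).2
    · rw [Finset.card_image_of_injective _ hinj]
      simp [ht]
  · intro f _ g _ hfg
    ext a
    exact congrFun hfg a
  · intro f hf
    simp only [Finset.mem_filter, Fintype.mem_piFinset] at hf
    refine ⟨⟨fun a => ⟨f a, hf.2 ▸ Finset.mem_image_of_mem _ (Finset.mem_univ a)⟩, fun a b hab =>
      hf.1.2 (congrArg Subtype.val hab)⟩, Finset.mem_univ _, rfl⟩

theorem sum_injective_prod_eq {α : Type*} [DecidableEq α] (S : Finset α) (z : α → ℂ) (n : ℕ) :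
    ∑ f ∈ (Fintype.piFinset fun _ : Fin n => S).filter Function.Injective, ∏ a, z (f a)
      = n ! * ∑ t ∈ S.powersetCard n, ∏ x ∈ t, z x := by
  have hmaps : ∀ f ∈ (Fintype.piFinset fun _ : Fin n => S).filter Function.Injective,
      Finset.univ.image f ∈ S.powersetCard n := by
    intro f hf
    simp only [Finset.mem_filter, Fintype.mem_piFinset] at hf
    rw [Finset.mem_powersetCard, Finset.card_image_of_injective _ hf.2]
    refine ⟨fun x hx => ?_, by simp⟩
    obtain ⟨a, -, rfl⟩ := Finset.mem_image.1 hx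
    exact hf.1 a
  rw [← Finset.sum_fiberwise_of_maps_to hmaps, Finset.mul_sum]
  refine Finset.sum_congr rfl fun t ht => ?_
  rw [Finset.mem_powersetCard] at ht
  rw [← card_filter_injective_image_eq ht.1 ht.2, ← nsmul_eq_mul, ← Finset.sum_const]
  refine Finset.sum_congr rfl fun f hf => ?_
  simp only [Finset.mem_filter] at hf
  rw [← hf.2, Finset.prod_image fun a _ b _ h => hf.1.2 h]

/-- Expand the product over subsets and group them by size; each n-subset has n! enumerations. This
brings in ordered tuples of distinct points, which are what intensities measure. -/
theorem hasSum_prod_one_add {α : Type*} [DecidableEq α] (S : Finset α) (z : α → ℂ) :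
    HasSum (fun n : ℕ => (n ! : ℂ)⁻¹ *
      ∑ f ∈ (Fintype.piFinset fun _ : Fin n => S).filter Function.Injective, ∏ a, z (f a))
      (∏ x ∈ S, (1 + z x)) := by
  have h : ∀ n : ℕ, (n ! : ℂ)⁻¹ *
      ∑ f ∈ (Fintype.piFinset fun _ : Fin n => S).filter Function.Injective, ∏ a, z (f a)
      = ∑ t ∈ S.powersetCard n, ∏ x ∈ t, z x := fun n => by
    rw [sum_injective_prod_eq, inv_mul_cancel_left₀ (by exact_mod_cast n.factorial_ne_zero)]
  simp_rw [h]
  rw [Finset.prod_one_add, Finset.sum_powerset]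
  refine hasSum_sum_of_ne_finset_zero fun n hn => ?_
  rw [Finset.powersetCard_eq_empty.2 (by simpa using hn), Finset.sum_empty]

/-- The number of ordered tuples of distinct points of the configuration `ξ` whose `a`-th point
lies in `A (c a)`. -/
noncomputable def tupleCount {E : Type*} [MeasurableSpace E] (ξ : Measure E) {ι : Type*}
    (A : ι → Set E) {n : ℕ} (c : Fin n → ι) : ℝ≥0∞ :=
  Measure.pi (fun _ : Fin n => ξ) (Set.univ.pi (fun a => A (c a)) ∩ {x | Function.Injective x})

/-- A point lies in at most one of the disjoint sets, so the sum has at most one nonzero term and 1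
plus the sum is a product. -/
theorem prod_one_add_sum_ite {E ι : Type*} [Fintype ι] {A : ι → Set E}
    (hA : Pairwise fun i j => Disjoint (A i) (A j)) (S : Finset E) (z : ι → ℂ)
    [∀ i, DecidablePred (· ∈ A i)] :
    ∏ x ∈ S, (1 + ∑ i, if x ∈ A i then z i else 0)
      = ∏ i, (1 + z i) ^ (S.filter (· ∈ A i)).card := by
  have h : ∀ x, (1 + ∑ i, if x ∈ A i then z i else 0)
      = ∏ i, if x ∈ A i then 1 + z i else 1 := by
    intro x
    by_cases hx : ∃ i, x ∈ A i
    · obtain ⟨i, hi⟩ := hx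
      have hne : ∀ j, j ≠ i → x ∉ A j := fun j hj hxj => (hA hj).le_bot ⟨hxj, hi⟩
      rw [Finset.sum_eq_single i (fun j _ hj => if_neg (hne j hj)) (by simp),
        Finset.prod_eq_single i (fun j _ hj => if_neg (hne j hj)) (by simp), if_pos hi, if_pos hi]
    · push Not at hx
      simp [hx]
  simp_rw [h]
  rw [Finset.prod_comm]
  refine Finset.prod_congr rfl fun i _ => ?_
  rw [← Finset.prod_filter, Finset.prod_const]

theorem measurableSet_pi_inter_injective {E : Type*} [TopologicalSpace E]
    [SecondCountableTopology E] [T2Space E] [MeasurableSpace E] [BorelSpace E] {ι : Type*}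
    {A : ι → Set E} (hAm : ∀ i, MeasurableSet (A i)) {n : ℕ} (c : Fin n → ι) :
    MeasurableSet (Set.univ.pi (fun a => A (c a)) ∩ {x | Function.Injective x}) := by
  refine (MeasurableSet.univ_pi fun a => hAm (c a)).inter ?_
  have : {x : Fin n → E | Function.Injective x} = ⋂ a, ⋂ b, ⋂ (_ : a ≠ b), {x | x a = x b}ᶜ := by
    ext x
    simp only [Set.mem_ofPred_eq, Set.mem_iInter, Set.mem_compl_iff]
    exact ⟨fun h a b hab he => hab (h he), fun h a b he => by_contra fun hab => h a b hab he⟩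
  rw [this]
  refine MeasurableSet.iInter fun a => MeasurableSet.iInter fun b => MeasurableSet.iInter fun _ => ?_
  exact (measurableSet_eq_fun (measurable_pi_apply a) (measurable_pi_apply b)).compl

section Counts

variable {E : Type*} [TopologicalSpace E] [SecondCountableTopology E] [T2Space E]
  [MeasurableSpace E] [BorelSpace E] {ι : Type*} [Fintype ι]

/-- The generating function of the counts of a simple configuration in disjoint sets is a series
in the tuple counts. -/
theorem hasSum_tupleCount {ξ : Measure E} [SigmaFinite ξ]
    (hint : ∀ A : Set E, MeasurableSet A → ∃ n : ℕ∞, ξ A = (n : ℝ≥0∞))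
    (hs : ∀ x, ξ {x} = 0 ∨ ξ {x} = 1) {A : ι → Set E}
    (hA : Pairwise fun i j => Disjoint (A i) (A j)) (hAm : ∀ i, MeasurableSet (A i))
    (hfin : ∀ i, ξ (A i) ≠ ∞) (z : ι → ℂ) :
    HasSum (fun n : ℕ => (n ! : ℂ)⁻¹ *
      ∑ c : Fin n → ι, (∏ a, z (c a)) * ((tupleCount ξ A c).toReal : ℂ))
      (∏ i, (1 + z i) ^ ⌊(ξ (A i)).toReal⌋₊) := by
  classical
  have hDm : MeasurableSet (⋃ i, A i) := MeasurableSet.iUnion hAm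
  have hDfin : ξ (⋃ i, A i) ≠ ∞ := by
    refine ((measure_iUnion_le _).trans_lt ?_).ne
    rw [tsum_fintype]
    exact ENNReal.sum_lt_top.2 fun i _ => (hfin i).lt_top
  obtain ⟨S, hS⟩ := exists_finset_restrict_eq_sum_dirac hint hs hDm hDfin
  have hcount : ∀ i, ξ (A i) = (S.filter (· ∈ A i)).card := by
    intro i
    rw [← Measure.restrict_eq_self ξ (Set.subset_iUnion A i), hS, Measure.coe_finsetSum,
      Finset.sum_apply]
    simp_rw [Measure.dirac_apply, Set.indicator_apply]
    simp
  have htuple : ∀ (n : ℕ) (c : Fin n → ι), (tupleCount ξ A c).toReal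
      = ∑ f ∈ (Fintype.piFinset fun _ : Fin n => S).filter Function.Injective,
        if ∀ a, f a ∈ A (c a) then (1 : ℝ) else 0 := by
    intro n c
    have hsub : Set.univ.pi (fun a => A (c a)) ∩ {x | Function.Injective x}
        ⊆ Set.univ.pi fun _ : Fin n => ⋃ i, A i :=
      fun x hx a _ => Set.mem_iUnion_of_mem (c a) (hx.1 a trivial)
    rw [tupleCount, ← Measure.restrict_eq_self _ hsub, Measure.restrict_pi_pi, hS, pi_sum_dirac,
      Measure.coe_finsetSum, Finset.sum_apply]
    simp_rw [Measure.dirac_apply, Set.indicator_apply]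
    rw [ENNReal.toReal_sum (fun f _ => by split_ifs <;> simp), Finset.sum_filter]
    refine Finset.sum_congr rfl fun f _ => ?_
    by_cases h1 : Function.Injective f <;> by_cases h2 : ∀ a, f a ∈ A (c a) <;> simp [h1, h2]
  -- Each point carries the weight `z i` of the cell containing it, and 0 if it lies in no cell.
  have hmain := hasSum_prod_one_add S (fun x => ∑ i, if x ∈ A i then z i else 0)
  rw [prod_one_add_sum_ite hA] at hmain
  simp_rw [hcount, ENNReal.toReal_natCast, Nat.floor_natCast]
  convert hmain using 3 with n
  simp_rw [htuple, Complex.ofReal_sum, Finset.mul_sum]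
  rw [Finset.sum_comm]
  refine Finset.sum_congr rfl fun f _ => ?_
  rw [Finset.prod_univ_sum, Fintype.piFinset_univ]
  refine Finset.sum_congr rfl fun c _ => ?_
  rw [Finset.prod_ite_zero]
  by_cases h : ∀ a, f a ∈ A (c a) <;> simp [h]

theorem aemeasurable_tupleCount [LocallyCompactSpace E] {P : Measure (Config E)} {A : ι → Set E}
    (hAm : ∀ i, MeasurableSet (A i)) (hfin : ∀ᵐ ξ ∂P, ∀ i, ξ.1 (A i) ≠ ∞) {n : ℕ}
    (c : Fin n → ι) : AEMeasurable (fun ξ : Config E => tupleCount ξ.1 A c) P := by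
  classical
  set D := ⋃ i, A i with hD
  have hDm : MeasurableSet D := MeasurableSet.iUnion hAm
  -- The π-system criterion for measurability of a family of measures is applied to finite measures.
  -- Hence ξ is cut down to `D`, and replaced by 0 in the null event that `D` has infinite mass.
  let G : Config E → Measure E := fun ξ => if ξ.1 D < ∞ then ξ.1.restrict D else 0
  have hGfin : ∀ ξ, IsFiniteMeasure (G ξ) := by
    intro ξ
    by_cases h : ξ.1 D < ∞
    · simp only [G, if_pos h]
      exact ⟨by rwa [Measure.restrict_apply_univ]⟩
    · simp only [G, if_neg h]
      infer_instance
  have hval : ∀ s, MeasurableSet s → Measurable fun ξ : Config E => ξ.1 s := fun s hs =>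
    (Measure.measurable_coe hs).comp measurable_subtype_coe
  have hG : ∀ s, MeasurableSet s → Measurable fun ξ => G ξ s := by
    intro s hs
    have : (fun ξ => G ξ s) = fun ξ : Config E => if ξ.1 D < ∞ then ξ.1 (s ∩ D) else 0 := by
      ext ξ
      by_cases h : ξ.1 D < ∞ <;> simp [G, h, Measure.restrict_apply hs]
    rw [this]
    exact Measurable.ite (measurableSet_lt (hval D hDm) measurable_const)
      (hval _ (hs.inter hDm)) measurable_const
  have hpi : Measurable fun ξ => Measure.pi fun _ : Fin n => G ξ := by
    refine Measurable.measure_of_isPiSystem generateFrom_pi.symm isPiSystem_pi ?_ ?_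
    · rintro _ ⟨s, hs, rfl⟩
      simp_rw [Measure.pi_pi]
      exact Finset.measurable_prod _ fun a _ => hG _ (hs a trivial)
    · simp_rw [Measure.pi_univ]
      exact Finset.measurable_prod _ fun a _ => hG _ MeasurableSet.univ
  refine ⟨_, (Measure.measurable_coe (measurableSet_pi_inter_injective hAm c)).comp hpi, ?_⟩
  filter_upwards [hfin] with ξ hξ
  have hDfin : ξ.1 D < ∞ := by
    refine (measure_iUnion_le _).trans_lt ?_
    rw [tsum_fintype]
    exact ENNReal.sum_lt_top.2 fun i _ => (hξ i).lt_top
  have hsub : Set.univ.pi (fun a => A (c a)) ∩ {x | Function.Injective x}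
      ⊆ Set.univ.pi fun _ : Fin n => D :=
    fun x hx a _ => Set.mem_iUnion_of_mem (c a) (hx.1 a trivial)
  simp only [Function.comp_apply, G, if_pos hDfin]
  rw [tupleCount, ← Measure.restrict_eq_self _ hsub, Measure.restrict_pi_pi]

end Counts

/-! ### Factorial moments and characteristic functions of counts. -/

section CountLaw

variable {E : Type*} [TopologicalSpace E] [MeasurableSpace E] {ι : Type*}

/-- The integral of the `n`-point determinantal intensity over a product of sets. -/
noncomputable def detMoment (μ : Measure E) (k : E → E → ℂ) (A : ι → Set E) {n : ℕ}
    (c : Fin n → ι) : ℝ≥0∞ :=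
  ∫⁻ x in Set.univ.pi (fun a => A (c a)),
    ENNReal.ofReal (Matrix.det (Matrix.of fun i j => k (x i) (x j))).re
      ∂(Measure.pi fun _ : Fin n => μ)

theorem lintegral_tupleCount {μ : Measure E} {k : E → E → ℂ}
    {P : Measure (Config E)} (hP : IsDeterminantalWith μ k P) {A : ι → Set E}
    (hAm : ∀ i, MeasurableSet (A i)) {n : ℕ} (c : Fin n → ι) :
    ∫⁻ ξ, tupleCount ξ.1 A c ∂P = detMoment μ k A c := by
  -- Intensities are prescribed only for n ≥ 1; for n = 0 both sides equal 1.
  rcases Nat.eq_zero_or_pos n with rfl | hn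
  · have := hP.isProbabilityMeasure
    have h1 : Set.univ.pi (fun a => A (c a)) = Set.univ := by
      ext x; simp
    have h2 : {x : Fin 0 → E | Function.Injective x} = Set.univ := by
      ext x; simp [Function.injective_of_subsingleton]
    simp [tupleCount, detMoment, h1, h2]
  · exact hP.intensity n hn _ (MeasurableSet.univ_pi fun a => hAm (c a))

theorem measurable_config_apply {s : Set E} (hs : MeasurableSet s) :
    Measurable fun ξ : Config E => ξ.1 s :=
  (Measure.measurable_coe hs).comp measurable_subtype_coe

theorem ae_config_apply_ne_top [SecondCountableTopology E] [LocallyCompactSpace E]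
    {μ : Measure E} {k : E → E → ℂ} {P : Measure (Config E)} (hP : IsDeterminantalWith μ k P) {A : ι → Set E}
    (hAm : ∀ i, MeasurableSet (A i)) (i : ι)
    (hM : detMoment μ k A (fun _ : Fin 1 => i) ≠ ∞) : ∀ᵐ ξ ∂P, ξ.1 (A i) ≠ ∞ := by
  rw [← lintegral_tupleCount hP hAm] at hM
  have h : ∀ ξ : Config E, tupleCount ξ.1 A (fun _ : Fin 1 => i) = ξ.1 (A i) := by
    intro ξ
    have h2 : {x : Fin 1 → E | Function.Injective x} = Set.univ := by
      ext x; simp [Function.injective_of_subsingleton]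
    rw [tupleCount, h2, Set.inter_univ, Measure.pi_pi]
    simp
  simp_rw [h] at hM
  filter_upwards [ae_lt_top (measurable_config_apply (hAm i)) hM] with ξ hξ using hξ.ne

/-- The vector of the counts in the sets `A i`, as real numbers. -/
noncomputable def countVector (A : ι → Set E) (ξ : Config E) : EuclideanSpace ℝ ι :=
  WithLp.toLp 2 fun i => (ξ.1 (A i)).toReal

theorem measurable_countVector {A : ι → Set E} (hAm : ∀ i, MeasurableSet (A i)) :
    Measurable (countVector A) :=
  (WithLp.measurable_toLp 2 _).comp
    (measurable_pi_lambda _ fun i => (measurable_config_apply (hAm i)).ennreal_toReal)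

variable [Fintype ι]

/-- The moment bound makes the n-th term have L¹ norm at most (∑ |z_i| t_i)^n / n!. This is summable
for every z, so expectation and series may be exchanged. -/
theorem hasSum_integral_counts [SecondCountableTopology E] [T2Space E] [LocallyCompactSpace E]
    [BorelSpace E] {μ : Measure E} {k : E → E → ℂ}
    {P : Measure (Config E)} (hP : IsDeterminantalWith μ k P) {A : ι → Set E}
    (hA : Pairwise fun i j => Disjoint (A i) (A j)) (hAm : ∀ i, MeasurableSet (A i))
    {t : ι → NNReal} (hM : ∀ (n : ℕ) (c : Fin n → ι), detMoment μ k A c ≤ ∏ a, (t (c a) : ℝ≥0∞))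
    (z : ι → ℂ) :
    HasSum (fun n : ℕ => (n ! : ℂ)⁻¹ *
      ∑ c : Fin n → ι, (∏ a, z (c a)) * ((detMoment μ k A c).toReal : ℂ))
      (∫ ξ, ∏ i, (1 + z i) ^ ⌊(ξ.1 (A i)).toReal⌋₊ ∂P) := by
  have hM' : ∀ (n : ℕ) (c : Fin n → ι), detMoment μ k A c ≠ ∞ := fun n c =>
    ((hM n c).trans_lt (ENNReal.prod_lt_top fun a _ => ENNReal.coe_lt_top)).ne
  have hfin : ∀ᵐ ξ ∂P, ∀ i, ξ.1 (A i) ≠ ∞ :=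
    ae_all_iff.2 fun i => ae_config_apply_ne_top hP hAm i (hM' _ _)
  have hTm : ∀ {n : ℕ} (c : Fin n → ι), AEMeasurable (fun ξ : Config E => tupleCount ξ.1 A c) P :=
    fun c => aemeasurable_tupleCount hAm hfin c
  have hTint : ∀ {n : ℕ} (c : Fin n → ι),
      Integrable (fun ξ : Config E => (tupleCount ξ.1 A c).toReal) P := fun c =>
    integrable_toReal_of_lintegral_ne_top (hTm c) (by rw [lintegral_tupleCount hP hAm]; exact hM' _ c)
  have hTval : ∀ {n : ℕ} (c : Fin n → ι),
      ∫ ξ, (tupleCount ξ.1 A c).toReal ∂P = (detMoment μ k A c).toReal := fun c => by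
    rw [integral_toReal (hTm c), lintegral_tupleCount hP hAm]
    exact ae_lt_top' (hTm c) (by rw [lintegral_tupleCount hP hAm]; exact hM' _ c)
  let f : ℕ → Config E → ℂ := fun n ξ => (n ! : ℂ)⁻¹ *
      ∑ c : Fin n → ι, (∏ a, z (c a)) * ((tupleCount ξ.1 A c).toReal : ℂ)
  have hfint : ∀ n, Integrable (f n) P := fun n =>
    (integrable_finsetSum _ fun c _ => ((hTint c).ofReal.const_mul _)).const_mul _
  have hnorm : ∀ n, ∫ ξ, ‖f n ξ‖ ∂P ≤ (∑ i, ‖z i‖ * t i) ^ n / n ! := by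
    intro n
    have hbd : ∀ ξ, ‖f n ξ‖ ≤ (n ! : ℝ)⁻¹ *
        ∑ c : Fin n → ι, (∏ a, ‖z (c a)‖) * (tupleCount ξ.1 A c).toReal := by
      intro ξ
      simp only [f]
      rw [norm_mul, norm_inv, Complex.norm_natCast]
      gcongr
      refine (norm_sum_le _ _).trans (Finset.sum_le_sum fun c _ => ?_)
      rw [norm_mul, norm_prod, Complex.norm_real, Real.norm_of_nonneg ENNReal.toReal_nonneg]
    have hint : Integrable (fun ξ : Config E => (n ! : ℝ)⁻¹ *
        ∑ c : Fin n → ι, (∏ a, ‖z (c a)‖) * (tupleCount ξ.1 A c).toReal) P :=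
      (integrable_finsetSum _ fun c _ => ((hTint c).const_mul _)).const_mul _
    refine (integral_mono (hfint n).norm hint hbd).trans ?_
    rw [integral_const_mul, integral_finsetSum _ fun c _ => ((hTint c).const_mul _)]
    simp_rw [integral_const_mul, hTval]
    rw [div_eq_inv_mul, Finset.sum_pow', Fintype.piFinset_univ]
    gcongr with c _
    rw [Finset.prod_mul_distrib]
    gcongr
    refine (ENNReal.toReal_mono (ENNReal.prod_lt_top fun a _ => ENNReal.coe_lt_top).ne
      (hM n c)).trans_eq ?_
    rw [ENNReal.toReal_prod]
    simp
  have hsum : Summable fun n => ∫ ξ, ‖f n ξ‖ ∂P :=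
    Summable.of_nonneg_of_le (fun n => integral_nonneg fun ξ => norm_nonneg _) hnorm
      (Real.summable_pow_div_factorial _)
  have key := hasSum_integral_of_summable_integral_norm hfint hsum
  have hval : ∀ n, ∫ ξ, f n ξ ∂P = (n ! : ℂ)⁻¹ *
      ∑ c : Fin n → ι, (∏ a, z (c a)) * ((detMoment μ k A c).toReal : ℂ) := by
    intro n
    simp only [f]
    rw [integral_const_mul, integral_finsetSum _ fun c _ => ((hTint c).ofReal.const_mul _)]
    simp_rw [integral_const_mul]
    congr 1
    refine Finset.sum_congr rfl fun c _ => ?_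
    rw [← hTval c]
    congr 1
    exact integral_ofReal
  simp_rw [hval] at key
  have heq : ∫ ξ, ∏ i, (1 + z i) ^ ⌊(ξ.1 (A i)).toReal⌋₊ ∂P = ∫ ξ, ∑' n, f n ξ ∂P := by
    refine integral_congr_ae ?_
    filter_upwards [hfin, hP.simple] with ξ hξ hξ'
    exact (hasSum_tupleCount ξ.2.2 hξ' hA hAm hξ z).tsum_eq.symm
  rw [heq]
  exact key

/-- Since exp(iθN) = (1 + z)^N with z = exp(iθ) - 1, the characteristic function is a value of the
generating function. Taking the floor loses nothing, as finite counts are natural numbers. -/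
theorem charFun_map_countVector {P : Measure (Config E)} {A : ι → Set E}
    (hAm : ∀ i, MeasurableSet (A i)) (hfin : ∀ᵐ ξ ∂P, ∀ i, ξ.1 (A i) ≠ ∞)
    (θ : EuclideanSpace ℝ ι) :
    charFun (P.map (countVector A)) θ = ∫ ξ, ∏ i,
      (1 + (Complex.exp (θ i * Complex.I) - 1)) ^ ⌊(ξ.1 (A i)).toReal⌋₊ ∂P := by
  rw [charFun_apply, integral_map (measurable_countVector hAm).aemeasurable
    (by fun_prop)]
  refine integral_congr_ae ?_
  filter_upwards [hfin] with ξ hξ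
  have hnat : ∀ i, (ξ.1 (A i)).toReal = ⌊(ξ.1 (A i)).toReal⌋₊ := by
    intro i
    obtain ⟨n, hn⟩ := ξ.2.2 (A i) (hAm i)
    have hne : n ≠ ⊤ := fun h => hξ i (by rw [hn, h]; rfl)
    lift n to ℕ using hne
    rw [hn]
    simp
  simp only [countVector, PiLp.inner_apply, RCLike.inner_apply, conj_trivial, add_sub_cancel]
  rw [Complex.ofReal_sum, Finset.sum_mul, Complex.exp_sum]
  refine Finset.prod_congr rfl fun i _ => ?_
  rw [← Complex.exp_nat_mul, hnat i]
  push_cast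
  simp only [Nat.floor_natCast]
  ring_nf

end CountLaw

theorem map_counts_eq_map_countVector {E ι : Type*} [TopologicalSpace E] [MeasurableSpace E]
    {P : Measure (Config E)} {A : ι → Set E}
    (hAm : ∀ i, MeasurableSet (A i)) (hfin : ∀ᵐ ξ ∂P, ∀ i, ξ.1 (A i) ≠ ∞) :
    P.map (fun ξ i => ξ.1 (A i))
      = (P.map (countVector A)).map fun v i => ENNReal.ofReal (v i) := by
  rw [Measure.map_map (by fun_prop) (measurable_countVector hAm)]
  refine Measure.map_congr ?_
  filter_upwards [hfin] with ξ hξ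
  ext i
  simp [countVector, ENNReal.ofReal_toReal (hξ i)]

/-! ### The factorial moments determine the law of the counts. -/

section Uniqueness

variable {E : Type*} [TopologicalSpace E] [SecondCountableTopology E] [T2Space E]
  [LocallyCompactSpace E] [MeasurableSpace E] [BorelSpace E]
  {E' : Type*} [TopologicalSpace E'] [SecondCountableTopology E'] [T2Space E']
  [LocallyCompactSpace E'] [MeasurableSpace E'] [BorelSpace E']
  {μ : Measure E} {k : E → E → ℂ} {P : Measure (Config E)}
  {μ' : Measure E'} {k' : E' → E' → ℂ} {P' : Measure (Config E')}

/-- Determinantal processes with the same determinantal moments have the same counts in law. -/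
theorem map_counts_eq {ι : Type*} [Fintype ι] (hP : IsDeterminantalWith μ k P)
    (hP' : IsDeterminantalWith μ' k' P') {A : ι → Set E} {A' : ι → Set E'}
    (hA : Pairwise fun i j => Disjoint (A i) (A j))
    (hA' : Pairwise fun i j => Disjoint (A' i) (A' j))
    (hAm : ∀ i, MeasurableSet (A i)) (hAm' : ∀ i, MeasurableSet (A' i)) {t : ι → NNReal}
    (hM : ∀ (n : ℕ) (c : Fin n → ι), detMoment μ k A c ≤ ∏ a, (t (c a) : ℝ≥0∞))
    (hMM : ∀ (n : ℕ) (c : Fin n → ι), detMoment μ k A c = detMoment μ' k' A' c) :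
    P.map (fun ξ i => ξ.1 (A i)) = P'.map (fun ξ i => ξ.1 (A' i)) := by
  have := hP.isProbabilityMeasure
  have := hP'.isProbabilityMeasure
  have hM' : ∀ (n : ℕ) (c : Fin n → ι), detMoment μ' k' A' c ≤ ∏ a, (t (c a) : ℝ≥0∞) :=
    fun n c => (hMM n c).ge.trans (hM n c)
  have hne : ∀ (n : ℕ) (c : Fin n → ι), detMoment μ k A c ≠ ∞ := fun n c =>
    ((hM n c).trans_lt (ENNReal.prod_lt_top fun a _ => ENNReal.coe_lt_top)).ne
  have hfin : ∀ᵐ ξ ∂P, ∀ i, ξ.1 (A i) ≠ ∞ :=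
    ae_all_iff.2 fun i => ae_config_apply_ne_top hP hAm i (hne _ _)
  have hfin' : ∀ᵐ ξ ∂P', ∀ i, ξ.1 (A' i) ≠ ∞ :=
    ae_all_iff.2 fun i => ae_config_apply_ne_top hP' hAm' i (by rw [← hMM]; exact hne _ _)
  rw [map_counts_eq_map_countVector hAm hfin, map_counts_eq_map_countVector hAm' hfin']
  refine congrArg (Measure.map fun (v : EuclideanSpace ℝ ι) i => ENNReal.ofReal (v i)) ?_
  have := Measure.isProbabilityMeasure_map (μ := P) (measurable_countVector hAm).aemeasurable
  have := Measure.isProbabilityMeasure_map (μ := P') (measurable_countVector hAm').aemeasurable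
  refine Measure.ext_of_charFun (funext fun θ => ?_)
  rw [charFun_map_countVector hAm hfin, charFun_map_countVector hAm' hfin']
  have h1 := hasSum_integral_counts hP hA hAm hM fun i => Complex.exp (θ i * Complex.I) - 1
  have h2 := hasSum_integral_counts hP' hA' hAm' hM' fun i => Complex.exp (θ i * Complex.I) - 1
  simp_rw [← hMM] at h2
  exact h1.unique h2

/-- A law on a countable product is determined by its finite-dimensional marginals, to which the
case of finitely many sets applies. -/
theorem jointCountLaw_eq (hP : IsDeterminantalWith μ k P) (hP' : IsDeterminantalWith μ' k' P')
    {A : ℕ → Set E} {A' : ℕ → Set E'}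
    (hA : Pairwise fun i j => Disjoint (A i) (A j))
    (hA' : Pairwise fun i j => Disjoint (A' i) (A' j))
    (hAm : ∀ i, MeasurableSet (A i)) (hAm' : ∀ i, MeasurableSet (A' i)) {t : ℕ → NNReal}
    (hM : ∀ (n : ℕ) (c : Fin n → ℕ), detMoment μ k A c ≤ ∏ a, (t (c a) : ℝ≥0∞))
    (hMM : ∀ (n : ℕ) (c : Fin n → ℕ), detMoment μ k A c = detMoment μ' k' A' c) :
    jointCountLaw P A = jointCountLaw P' A' := by
  have := hP.isProbabilityMeasure
  have := hP'.isProbabilityMeasure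
  have hm : Measurable fun (ξ : Config E) i => ξ.1 (A i) :=
    measurable_pi_lambda _ fun i => measurable_config_apply (hAm i)
  have hm' : Measurable fun (ξ : Config E') i => ξ.1 (A' i) :=
    measurable_pi_lambda _ fun i => measurable_config_apply (hAm' i)
  have : IsProbabilityMeasure (jointCountLaw P A) := Measure.isProbabilityMeasure_map hm.aemeasurable
  refine IsProjectiveLimit.unique (P := fun I => (jointCountLaw P A).map I.restrict)
    (fun I => rfl) (fun I => ?_)
  change (P'.map _).map I.restrict = (P.map _).map I.restrict
  rw [Measure.map_map (by fun_prop) hm, Measure.map_map (by fun_prop) hm']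
  exact (map_counts_eq (ι := I) hP hP' (A := fun i => A i) (A' := fun i => A' i)
    (fun i j hij => hA (Subtype.coe_ne_coe.2 hij)) (fun i j hij => hA' (Subtype.coe_ne_coe.2 hij))
    (fun i => hAm i) (fun i => hAm' i) (t := fun i => t i) (fun n c => hM n fun a => c a)
    (fun n c => hMM n fun a => c a)).symm

end Uniqueness

/-! ### Moments of kernels in Gram form. -/

theorem lintegral_fin_prod_eq_prod {E : Type*} [MeasurableSpace E] {n : ℕ} (μ : Fin n → Measure E)
    [∀ i, SigmaFinite (μ i)] (f : Fin n → E → ℝ≥0∞) (hf : ∀ i, Measurable (f i)) :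
    ∫⁻ x, ∏ i, f i (x i) ∂(Measure.pi μ) = ∏ i, ∫⁻ x, f i x ∂(μ i) := by
  induction n with
  | zero => simp
  | succ n ih =>
    rw [← ((measurePreserving_piFinSuccAbove μ 0).symm).lintegral_comp_emb
      (MeasurableEquiv.measurableEmbedding _)]
    have h : ∀ p : E × (Fin n → E),
        ∏ i, f i ((MeasurableEquiv.piFinSuccAbove (fun _ => E) 0).symm p i)
        = f 0 p.1 * ∏ i : Fin n, f i.succ (p.2 i) := by
      intro p
      rw [Fin.prod_univ_succ]
      rfl
    simp_rw [h]
    rw [Fin.prod_univ_succ, ← ih (fun i => μ i.succ) (fun i => f i.succ) (fun i => hf _)]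
    exact lintegral_prod_mul (hf 0).aemeasurable
      (Finset.measurable_prod _ fun i _ => (hf _).comp (measurable_pi_apply i)).aemeasurable

/-- This carries properties that hold μ²-almost everywhere to pairs of distinct coordinates of a
point of Eⁿ. The total mass of μ need not be 1, so only null sets are respected. -/
theorem quasiMeasurePreserving_eval_pair {E : Type*} [MeasurableSpace E] (μ : Measure E)
    [SigmaFinite μ] {n : ℕ} {a b : Fin n} (hab : a ≠ b) :
    Measure.QuasiMeasurePreserving (fun x : Fin n → E => (x a, x b))
      (Measure.pi fun _ => μ) (μ.prod μ) := by
  cases n with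
  | zero => exact a.elim0
  | succ n =>
    obtain ⟨b', rfl⟩ := Fin.exists_succAbove_eq hab.symm
    have h1 := (measurePreserving_piFinSuccAbove (fun _ : Fin (n + 1) => μ) a).quasiMeasurePreserving
    have h2 : Measure.QuasiMeasurePreserving
        (Prod.map id (Function.eval b') : E × (Fin n → E) → E × E)
        (μ.prod (Measure.pi fun _ => μ)) (μ.prod μ) := by
      refine ⟨by fun_prop, ?_⟩
      rw [← Measure.map_prod_map _ _ measurable_id (measurable_pi_apply b')]
      refine Measure.AbsolutelyContinuous.prod ?_ ?_
      · rw [Measure.map_id]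
      · exact (Measure.quasiMeasurePreserving_eval (fun _ : Fin n => μ) b').absolutelyContinuous
    exact h2.comp h1

section GramMatrix

variable {E J : Type*}

/-- The matrix of the truncated kernel `∑ j ∈ s, v j x * conj (v j y)` at the points `x`. -/
noncomputable def gramMatrix (v : J → E → ℂ) (s : Finset J) {n : ℕ} (x : Fin n → E) :
    Matrix (Fin n) (Fin n) ℂ :=
  Matrix.of fun a b => ∑ j ∈ s, v j (x a) * conj (v j (x b))

theorem posSemidef_gramMatrix (v : J → E → ℂ) (s : Finset J) {n : ℕ} (x : Fin n → E) :
    (gramMatrix v s x).PosSemidef := by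
  have : gramMatrix v s x = (Matrix.of fun (a : Fin n) (j : s) => v j (x a)) *
      (Matrix.of fun (a : Fin n) (j : s) => v j (x a)).conjTranspose := by
    ext a b
    rw [gramMatrix, Matrix.mul_apply, Matrix.of_apply, ← Finset.sum_coe_sort]
    rfl
  rw [this]
  exact Matrix.posSemidef_self_mul_conjTranspose _

/-- Hadamard's inequality supplies a bound independent of the truncation `s`, the dominating
function for the passage to the limit. -/
theorem ofReal_det_gramMatrix_le (v : J → E → ℂ) (s : Finset J) {n : ℕ} (x : Fin n → E) :
    ENNReal.ofReal (gramMatrix v s x).det.re ≤ ∏ a, ∑' j, ‖v j (x a)‖ₑ ^ 2 := by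
  have h0 : ∀ a, (gramMatrix v s x a a).re = ∑ j ∈ s, ‖v j (x a)‖ ^ 2 := by
    intro a
    simp only [gramMatrix, Matrix.of_apply, Complex.mul_conj', Complex.re_sum]
    norm_cast
  refine (ENNReal.ofReal_le_ofReal (posSemidef_gramMatrix v s x).det_le_prod_diag).trans ?_
  simp_rw [h0]
  rw [ENNReal.ofReal_prod_of_nonneg fun a _ => Finset.sum_nonneg fun j _ => sq_nonneg _]
  refine Finset.prod_le_prod' fun a _ => ?_
  rw [ENNReal.ofReal_sum_of_nonneg fun j _ => sq_nonneg _]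
  refine le_trans (le_of_eq ?_) (ENNReal.sum_le_tsum s)
  refine Finset.sum_congr rfl fun j _ => ?_
  rw [ENNReal.ofReal_pow (norm_nonneg _), ofReal_norm]

end GramMatrix

section Gram

variable {E : Type*} [MeasurableSpace E] {J : Type*}

/-- The functions `v j` represent `k` as the kernel `∑ j, v j x * conj (v j y)`, almost everywhere
off the diagonal and almost everywhere on the diagonal. -/
structure IsGram (μ : Measure E) (k : E → E → ℂ) (v : J → E → ℂ) : Prop where
  measurable : ∀ j, Measurable (v j)
  off_diagonal : ∀ᵐ p ∂μ.prod μ, HasSum (fun j => v j p.1 * conj (v j p.2)) (k p.1 p.2)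
  diagonal : ∀ᵐ x ∂μ, HasSum (fun j => v j x * conj (v j x)) (k x x)

theorem measurable_det_gramMatrix {v : J → E → ℂ} (hv : ∀ j, Measurable (v j)) (s : Finset J)
    (n : ℕ) : Measurable fun x : Fin n → E => (gramMatrix v s x).det := by
  have : ∀ j a, Measurable fun x : Fin n → E => v j (x a) :=
    fun j a => (hv j).comp (measurable_pi_apply a)
  simp only [gramMatrix, Matrix.det_apply, Matrix.of_apply]
  fun_prop

/-- Each matrix entry involves one pair of coordinates, or a single coordinate. The diagonal of E ×
E may be μ²-null, so diagonal entries need their own hypothesis. -/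
theorem IsGram.ae_tendsto {μ : Measure E} [SigmaFinite μ] {k : E → E → ℂ} {v : J → E → ℂ}
    (h : IsGram μ k v) (n : ℕ) :
    ∀ᵐ x ∂(Measure.pi fun _ : Fin n => μ), Filter.Tendsto
      (fun s => ENNReal.ofReal (gramMatrix v s x).det.re) Filter.atTop
      (nhds (ENNReal.ofReal (Matrix.det (Matrix.of fun i j => k (x i) (x j))).re)) := by
  have hall : ∀ᵐ x ∂(Measure.pi fun _ : Fin n => μ), ∀ a b,
      HasSum (fun j => v j (x a) * conj (v j (x b))) (k (x a) (x b)) := by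
    simp_rw [ae_all_iff]
    intro a b
    rcases eq_or_ne a b with rfl | hab
    · exact (Measure.quasiMeasurePreserving_eval (fun _ : Fin n => μ) a).ae h.diagonal
    · exact (quasiMeasurePreserving_eval_pair μ hab).ae h.off_diagonal
  filter_upwards [hall] with x hx
  have hM : Filter.Tendsto (fun s => gramMatrix v s x) Filter.atTop
      (nhds (Matrix.of fun i j => k (x i) (x j))) :=
    tendsto_pi_nhds.2 fun a => tendsto_pi_nhds.2 fun b => hx a b
  have hc : Continuous fun M : Matrix (Fin n) (Fin n) ℂ => ENNReal.ofReal M.det.re :=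
    ENNReal.continuous_ofReal.comp (Complex.continuous_re.comp continuous_id.matrix_det)
  exact (hc.tendsto _).comp hM

variable {ι : Type*}

/-- Dominated convergence along finite subsets of the countable set J. The dominating function is a
product over the coordinates, so its integral factors into finite integrals. -/
theorem IsGram.tendsto_detMoment [TopologicalSpace E] [Countable J] {μ : Measure E} [SigmaFinite μ]
    {k : E → E → ℂ} {v : J → E → ℂ} (h : IsGram μ k v) {A : ι → Set E}
    (hfin : ∀ i, ∫⁻ x in A i, ∑' j, ‖v j x‖ₑ ^ 2 ∂μ ≠ ∞) {n : ℕ} (c : Fin n → ι) :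
    Filter.Tendsto (fun s => ∫⁻ x in Set.univ.pi fun a => A (c a),
      ENNReal.ofReal (gramMatrix v s x).det.re ∂(Measure.pi fun _ : Fin n => μ)) Filter.atTop
      (nhds (detMoment μ k A c)) ∧
    detMoment μ k A c ≤ ∏ a, ∫⁻ x in A (c a), ∑' j, ‖v j x‖ₑ ^ 2 ∂μ := by
  have hV : Measurable fun x => ∑' j, ‖v j x‖ₑ ^ 2 :=
    Measurable.tsum fun j => (h.measurable j).enorm.pow_const 2
  have hbound : ∫⁻ x in Set.univ.pi fun a => A (c a), ∏ a, ∑' j, ‖v j (x a)‖ₑ ^ 2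
      ∂(Measure.pi fun _ : Fin n => μ) = ∏ a, ∫⁻ x in A (c a), ∑' j, ‖v j x‖ₑ ^ 2 ∂μ := by
    rw [Measure.restrict_pi_pi]
    exact lintegral_fin_prod_eq_prod (fun a => μ.restrict (A (c a))) (fun _ x => ∑' j, ‖v j x‖ₑ ^ 2)
      fun _ => hV
  have ht : Filter.Tendsto (fun s => ∫⁻ x in Set.univ.pi fun a => A (c a),
      ENNReal.ofReal (gramMatrix v s x).det.re ∂(Measure.pi fun _ : Fin n => μ)) Filter.atTop
      (nhds (detMoment μ k A c)) := by
    refine tendsto_lintegral_filter_of_dominated_convergence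
      (fun x => ∏ a, ∑' j, ‖v j (x a)‖ₑ ^ 2) ?_ ?_ ?_ (ae_restrict_of_ae (h.ae_tendsto n))
    · exact Filter.Eventually.of_forall fun s => ENNReal.measurable_ofReal.comp
        (Complex.measurable_re.comp (measurable_det_gramMatrix h.measurable s n))
    · exact Filter.Eventually.of_forall fun s => Filter.Eventually.of_forall fun x =>
        ofReal_det_gramMatrix_le v s x
    · rw [hbound]
      exact (ENNReal.prod_lt_top fun a _ => (hfin (c a)).lt_top).ne
  refine ⟨ht, le_of_tendsto' ht fun s => ?_⟩
  rw [← hbound]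
  exact lintegral_mono fun x => ofReal_det_gramMatrix_le v s x

/-- The value of the truncated determinantal moments in terms of the Gram numbers `G`. -/
noncomputable def gramSum (G : ι → J → J → ℂ) (s : Finset J) {n : ℕ} (c : Fin n → ι) : ℂ :=
  ∑ σ : Equiv.Perm (Fin n), ((Equiv.Perm.sign σ : ℤ) : ℂ) *
    ∑ f ∈ Fintype.piFinset fun _ : Fin n => s, ∏ a, G (c a) (f (σ.symm a)) (f a)

/-- After the Leibniz formula and the expansion of every entry, each term is a product of functions
of single coordinates, and its integral is a product of Gram numbers. -/
theorem lintegral_det_gramMatrix {μ : Measure E} [SigmaFinite μ] {v : J → E → ℂ}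
    (hv : ∀ j, Measurable (v j)) {A : ι → Set E}
    (hfin : ∀ i j, ∫⁻ x in A i, ‖v j x‖ₑ ^ 2 ∂μ ≠ ∞) (s : Finset J) {n : ℕ} (c : Fin n → ι) :
    ∫⁻ x in Set.univ.pi fun a => A (c a),
      ENNReal.ofReal (gramMatrix v s x).det.re ∂(Measure.pi fun _ : Fin n => μ)
    = ENNReal.ofReal (gramSum (fun i j l => ∫ x in A i, v j x * conj (v l x) ∂μ) s c).re := by
  have hLp : ∀ i j, MemLp (v j) 2 (μ.restrict (A i)) := fun i j => by
    refine ⟨(hv j).aestronglyMeasurable, ?_⟩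
    rw [eLpNorm_lt_top_iff_lintegral_rpow_enorm_lt_top (by simp) (by simp)]
    simpa using (hfin i j).lt_top
  have hint : ∀ i j l, Integrable (fun x => v j x * conj (v l x)) (μ.restrict (A i)) :=
    fun i j l => (hLp i j).integrable_mul (hLp i l).star
  have hprod : ∀ (σ : Equiv.Perm (Fin n)) (f : Fin n → J), Integrable
      (fun x : Fin n → E => ∏ a, (v (f (σ.symm a)) (x a) * conj (v (f a) (x a))))
      (Measure.pi fun a => μ.restrict (A (c a))) := fun σ f =>
    Integrable.fintype_prod (f := fun a y => v (f (σ.symm a)) y * conj (v (f a) y))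
      fun a => hint _ _ _
  have hdet : ∀ x : Fin n → E, (gramMatrix v s x).det = ∑ σ : Equiv.Perm (Fin n),
      ((Equiv.Perm.sign σ : ℤ) : ℂ) * ∑ f ∈ Fintype.piFinset fun _ : Fin n => s,
        ∏ a, (v (f (σ.symm a)) (x a) * conj (v (f a) (x a))) := by
    intro x
    rw [Matrix.det_apply']
    refine Finset.sum_congr rfl fun σ _ => ?_
    congr 1
    simp only [gramMatrix, Matrix.of_apply]
    rw [Finset.prod_univ_sum]
    refine Finset.sum_congr rfl fun f _ => ?_
    rw [Finset.prod_mul_distrib, Finset.prod_mul_distrib]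
    congr 1
    -- Reindexing by σ collects the two factors that depend on the same coordinate.
    rw [← Equiv.prod_comp σ fun a => v (f (σ.symm a)) (x a)]
    simp
  have hI : Integrable (fun x : Fin n → E => (gramMatrix v s x).det)
      (Measure.pi fun a => μ.restrict (A (c a))) := by
    refine Integrable.congr (f := fun x => _) ?_
      (Filter.Eventually.of_forall fun x => (hdet x).symm)
    exact integrable_finsetSum _
      fun σ _ => (integrable_finsetSum _ fun f _ => hprod σ f).const_mul _
  have hval : ∫ x, (gramMatrix v s x).det ∂(Measure.pi fun a => μ.restrict (A (c a)))
      = gramSum (fun i j l => ∫ x in A i, v j x * conj (v l x) ∂μ) s c := by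
    rw [integral_congr_ae (Filter.Eventually.of_forall hdet), integral_finsetSum _
      fun σ _ => (integrable_finsetSum _ fun f _ => hprod σ f).const_mul _]
    refine Finset.sum_congr rfl fun σ _ => ?_
    rw [integral_const_mul, integral_finsetSum _ fun f _ => hprod σ f]
    congr 1
    refine Finset.sum_congr rfl fun f _ => ?_
    exact integral_fintype_prod_eq_prod (fun a y => v (f (σ.symm a)) y * conj (v (f a) y))
  have hre : Integrable (fun x : Fin n → E => (gramMatrix v s x).det.re)
      (Measure.pi fun a => μ.restrict (A (c a))) := hI.re
  rw [Measure.restrict_pi_pi, ← hval, ← ofReal_integral_eq_lintegral_ofReal hre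
    (Filter.Eventually.of_forall fun x =>
      (Complex.le_def.1 (posSemidef_gramMatrix v s x).det_nonneg).1)]
  congr 1
  exact integral_re hI

end Gram

section Comparison

variable {E : Type*} [TopologicalSpace E] [SecondCountableTopology E] [T2Space E]
  [LocallyCompactSpace E] [MeasurableSpace E] [BorelSpace E]
  {E' : Type*} [TopologicalSpace E'] [SecondCountableTopology E'] [T2Space E']
  [LocallyCompactSpace E'] [MeasurableSpace E'] [BorelSpace E']
  {μ : Measure E} [SigmaFinite μ] {k : E → E → ℂ} {P : Measure (Config E)}
  {μ' : Measure E'} [SigmaFinite μ'] {k' : E' → E' → ℂ} {P' : Measure (Config E')}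
  {J : Type*} [Countable J] {v : J → E → ℂ} {v' : J → E' → ℂ}

/-- Determinantal processes whose kernels have the same Gram numbers on disjoint sets have the same
joint law of the counts in these sets. -/
theorem IsGram.jointCountLaw_eq (h : IsGram μ k v) (h' : IsGram μ' k' v')
    (hP : IsDeterminantalWith μ k P) (hP' : IsDeterminantalWith μ' k' P')
    {A : ℕ → Set E} {A' : ℕ → Set E'}
    (hA : Pairwise fun i j => Disjoint (A i) (A j))
    (hA' : Pairwise fun i j => Disjoint (A' i) (A' j))
    (hAm : ∀ i, MeasurableSet (A i)) (hAm' : ∀ i, MeasurableSet (A' i))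
    (hfin : ∀ i, ∫⁻ x in A i, ∑' j, ‖v j x‖ₑ ^ 2 ∂μ ≠ ∞)
    (hfin' : ∀ i, ∫⁻ x in A' i, ∑' j, ‖v' j x‖ₑ ^ 2 ∂μ' ≠ ∞)
    (hG : ∀ i j l, ∫ x in A i, v j x * conj (v l x) ∂μ = ∫ x in A' i, v' j x * conj (v' l x) ∂μ') :
    jointCountLaw P A = jointCountLaw P' A' := by
  have hle : ∀ i j, ∫⁻ x in A i, ‖v j x‖ₑ ^ 2 ∂μ ≠ ∞ := fun i j =>
    ((lintegral_mono fun x => ENNReal.le_tsum j).trans_lt (hfin i).lt_top).ne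
  have hle' : ∀ i j, ∫⁻ x in A' i, ‖v' j x‖ₑ ^ 2 ∂μ' ≠ ∞ := fun i j =>
    ((lintegral_mono fun x => ENNReal.le_tsum j).trans_lt (hfin' i).lt_top).ne
  refine DPP.jointCountLaw_eq hP hP' hA hA' hAm hAm'
    (t := fun i => (∫⁻ x in A i, ∑' j, ‖v j x‖ₑ ^ 2 ∂μ).toNNReal) (fun n c => ?_) (fun n c => ?_)
  · refine (h.tendsto_detMoment hfin c).2.trans_eq (Finset.prod_congr rfl fun a _ => ?_)
    rw [ENNReal.coe_toNNReal (hfin _)]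
  · refine tendsto_nhds_unique (h.tendsto_detMoment hfin c).1 ?_
    have := (h'.tendsto_detMoment hfin' c).1
    simp_rw [lintegral_det_gramMatrix h'.measurable hle'] at this
    simp_rw [lintegral_det_gramMatrix h.measurable hle, hG]
    exact this

end Comparison

/-! ### Square roots, traces and restrictions. -/

/-- Parseval's identity in `[0, ∞]`. -/
theorem _root_.HilbertBasis.tsum_enorm_inner_sq {H : Type*} [NormedAddCommGroup H]
    [InnerProductSpace ℂ H] {J : Type*} (b : HilbertBasis J ℂ H) (x : H) :
    ∑' j, ‖inner ℂ (b j) x‖ₑ ^ 2 = ‖x‖ₑ ^ 2 := by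
  have h := b.hasSum_inner_mul_inner x x
  have h2 : HasSum (fun j => ‖inner ℂ (b j) x‖ ^ 2) (‖x‖ ^ 2) := by
    have e1 : (fun j => inner ℂ x (b j) * inner ℂ (b j) x)
        = fun j => (((‖inner ℂ (b j) x‖ ^ 2 : ℝ)) : ℂ) := by
      ext j
      rw [← inner_conj_symm, Complex.conj_mul']
      norm_cast
    rw [e1, inner_self_eq_norm_sq_to_K] at h
    refine Complex.hasSum_ofReal.1 ?_
    convert! h using 1
    norm_cast
  have e : ∀ y : ℝ, 0 ≤ y → ENNReal.ofReal (y ^ 2) = ENNReal.ofReal y ^ 2 := fun y hy =>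
    ENNReal.ofReal_pow hy 2
  rw [← ofReal_norm, ← e _ (norm_nonneg _), ← h2.tsum_eq,
    ENNReal.ofReal_tsum_of_nonneg (fun j => sq_nonneg _) h2.summable]
  exact tsum_congr fun j => by rw [e _ (norm_nonneg _), ofReal_norm]

section Hilbert

variable {H : Type*} [NormedAddCommGroup H] [InnerProductSpace ℂ H] [CompleteSpace H]

theorem exists_isSelfAdjoint_comp_self_eq {K : H →L[ℂ] H} (hK : K.IsPositive) :
    ∃ R : H →L[ℂ] H, IsSelfAdjoint R ∧ R ∘L R = K := by
  have h0 : 0 ≤ K := (ContinuousLinearMap.nonneg_iff_isPositive K).2 hK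
  exact ⟨CFC.sqrt K, (CFC.sqrt_nonneg K).isSelfAdjoint, CFC.sqrt_mul_sqrt_self K h0⟩

theorem _root_.IsSelfAdjoint.inner_map_eq {R : H →L[ℂ] H} (hR : IsSelfAdjoint R) (x y : H) :
    inner ℂ (R x) y = inner ℂ x (R y) := by
  rw [← ContinuousLinearMap.adjoint_inner_right, ContinuousLinearMap.isSelfAdjoint_iff'.1 hR]

/-- ⟨w, pR²pw⟩ = ‖Rpw‖². Parseval in `b`, exchange of the sums and Parseval in `w` give the squared
Hilbert–Schmidt norm of pR. -/
theorem traceAlong_compress {I J : Type*} {R p : H →L[ℂ] H} (hR : IsSelfAdjoint R)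
    (hp : IsSelfAdjoint p) (w : HilbertBasis I ℂ H) (b : HilbertBasis J ℂ H) :
    traceAlong w (p ∘L (R ∘L R) ∘L p) = ∑' j, ‖p (R (b j))‖ₑ ^ 2 := by
  have h1 : ∀ i, ENNReal.ofReal (inner ℂ (w i) ((p ∘L (R ∘L R) ∘L p) (w i))).re
      = ∑' j, ‖inner ℂ (w i) (p (R (b j)))‖ₑ ^ 2 := by
    intro i
    have : inner ℂ (w i) ((p ∘L (R ∘L R) ∘L p) (w i))
        = inner ℂ (R (p (w i))) (R (p (w i))) := by
      rw [hR.inner_map_eq, hp.inner_map_eq]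
      rfl
    rw [this, inner_self_eq_norm_sq_to_K]
    have h2 : (((‖R (p (w i))‖ : ℝ) : ℂ) ^ 2).re = ‖R (p (w i))‖ ^ 2 := by norm_cast
    erw [h2]
    rw [ENNReal.ofReal_pow (norm_nonneg _), ofReal_norm, ← b.tsum_enorm_inner_sq]
    refine tsum_congr fun j => ?_
    rw [← hR.inner_map_eq, ← hp.inner_map_eq, ← inner_conj_symm, RCLike.enorm_conj]
  rw [traceAlong]
  simp_rw [h1]
  rw [ENNReal.tsum_comm]
  exact tsum_congr fun j => w.tsum_enorm_inner_sq _

end Hilbert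

/-- Orthonormal vectors are at mutual distance √2, so balls of radius 1/2 around them are disjoint.
-/
theorem countable_of_orthonormal {H : Type*} [NormedAddCommGroup H] [InnerProductSpace ℂ H]
    [TopologicalSpace.SeparableSpace H] {J : Type*} {v : J → H}
    (hv : Orthonormal ℂ v) : Countable J := by
  refine Pairwise.countable_of_isOpen_disjoint (s := fun j => Metric.ball (v j) (1 / 2)) ?_
    (fun j => Metric.isOpen_ball) (fun j => Metric.nonempty_ball.2 (by norm_num))
  intro i j hij
  refine Metric.ball_disjoint_ball ?_
  have h : ‖v i - v j‖ ^ 2 = 2 := by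
    rw [@norm_sub_sq ℂ, hv.1, hv.1, hv.2 hij]
    norm_num
  rw [dist_eq_norm]
  nlinarith [norm_nonneg (v i - v j)]

section Restrict

variable {E : Type*} [MeasurableSpace E] {μ : Measure E}

theorem coeFn_restrictL {A : Set E} (hA : MeasurableSet A) (f : Lp ℂ 2 μ) :
    restrictL μ hA f =ᵐ[μ] A.indicator f :=
  ((Lp.memLp f).indicator hA).coeFn_toLp

theorem inner_restrictL {A : Set E} (hA : MeasurableSet A) (f g : Lp ℂ 2 μ) :
    inner ℂ f (restrictL μ hA g) = ∫ x in A, g x * conj (f x) ∂μ := by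
  rw [L2.inner_def, ← integral_indicator hA]
  refine integral_congr_ae ?_
  filter_upwards [coeFn_restrictL hA g] with x hx
  rw [hx]
  by_cases h : x ∈ A <;> simp [h]

theorem isSelfAdjoint_restrictL {A : Set E} (hA : MeasurableSet A) :
    IsSelfAdjoint (restrictL μ hA) := by
  rw [ContinuousLinearMap.isSelfAdjoint_iff_isSymmetric]
  intro f g
  change inner ℂ (restrictL μ hA f) g = inner ℂ f (restrictL μ hA g)
  rw [← inner_conj_symm, inner_restrictL, inner_restrictL, ← integral_conj]
  refine integral_congr_ae (Filter.Eventually.of_forall fun x => ?_)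
  simp [mul_comm]

theorem restrictL_comp_restrictL {A B : Set E} (hA : MeasurableSet A) (hB : MeasurableSet B)
    (f : Lp ℂ 2 μ) : restrictL μ hA (restrictL μ hB f) = restrictL μ (hA.inter hB) f := by
  ext1
  filter_upwards [coeFn_restrictL hA (restrictL μ hB f), coeFn_restrictL hB f,
    coeFn_restrictL (hA.inter hB) f] with x h1 h2 h3
  rw [h1, h3, ← Set.indicator_indicator]
  by_cases h : x ∈ A <;> simp [h, h2]

theorem restrictL_eq_zero_of_eq_empty {A : Set E} (hA : MeasurableSet A) (h : A = ∅)
    (f : Lp ℂ 2 μ) : restrictL μ hA f = 0 := by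
  subst h
  ext1
  filter_upwards [coeFn_restrictL hA f, Lp.coeFn_zero ℂ 2 μ] with x h1 h2
  rw [h1, h2]
  simp

theorem enorm_restrictL_sq {A : Set E} (hA : MeasurableSet A) (f : Lp ℂ 2 μ) :
    ‖restrictL μ hA f‖ₑ ^ 2 = ∫⁻ x in A, ‖f x‖ₑ ^ 2 ∂μ := by
  have h : restrictL μ hA f = ((Lp.memLp f).indicator hA).toLp (A.indicator f) := rfl
  rw [h, Lp.enorm_toLp, eLpNorm_indicator_eq_eLpNorm_restrict hA,
    eLpNorm_eq_lintegral_rpow_enorm_toReal (by simp) (by simp)]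
  simp only [ENNReal.toReal_ofNat, ENNReal.rpow_ofNat, one_div]
  rw [← ENNReal.rpow_natCast, ← ENNReal.rpow_mul]
  simp

/-- The integrand is the diagonal of the Gram kernel of the vectors R b_j. Being locally trace-class
thus amounts to its local integrability. -/
theorem lintegral_tsum_eq_traceAlong {I J : Type*} [Countable J] {K R : Lp ℂ 2 μ →L[ℂ] Lp ℂ 2 μ}
    (hR : IsSelfAdjoint R) (hRK : R ∘L R = K) (b : HilbertBasis J ℂ (Lp ℂ 2 μ))
    (w : HilbertBasis I ℂ (Lp ℂ 2 μ)) {A : Set E} (hA : MeasurableSet A) :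
    ∫⁻ x in A, ∑' j, ‖R (b j) x‖ₑ ^ 2 ∂μ = traceAlong w (compression μ K hA) := by
  rw [lintegral_tsum fun j => ((Lp.stronglyMeasurable _).measurable.enorm.pow_const 2).aemeasurable,
    compression, ← hRK, traceAlong_compress hR (isSelfAdjoint_restrictL hA) w b]
  exact tsum_congr fun j => (enorm_restrictL_sq hA _).symm

end Restrict

/-! ### The kernel of K in Gram form. -/

/-- Integrable functions on a product are determined by their integrals over rectangles. -/
theorem ae_eq_of_forall_setIntegral_prod_eq {X Y : Type*} [MeasurableSpace X] [MeasurableSpace Y]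
    {ν : Measure (X × Y)} {f g : X × Y → ℂ}
    (hf : Integrable f ν) (hg : Integrable g ν)
    (h : ∀ s t, MeasurableSet s → MeasurableSet t → ∫ p in s ×ˢ t, f p ∂ν = ∫ p in s ×ˢ t, g p ∂ν) :
    f =ᵐ[ν] g := by
  have huniv : ∫ p, f p ∂ν = ∫ p, g p ∂ν := by
    simpa using h Set.univ Set.univ MeasurableSet.univ MeasurableSet.univ
  suffices key : ∀ S, MeasurableSet S → ∫ p in S, f p ∂ν = ∫ p in S, g p ∂ν from
    Integrable.ae_eq_of_forall_setIntegral_eq f g hf hg fun S hS _ => key S hS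
  intro S hS
  induction S, hS using MeasurableSpace.induction_on_inter generateFrom_prod.symm isPiSystem_prod with
  | empty => simp
  | basic u hu =>
    obtain ⟨s, hs, t, ht, rfl⟩ := hu
    exact h s t hs ht
  | compl u hu ih =>
    have h1 := integral_add_compl hu hf
    have h2 := integral_add_compl hu hg
    rw [ih] at h1
    rw [huniv, ← h2] at h1
    exact add_left_cancel h1
  | iUnion u hd hu ih =>
    rw [integral_iUnion hu hd hf.integrableOn, integral_iUnion hu hd hg.integrableOn]
    exact tsum_congr fun i => ih i

theorem tsum_enorm_mul_le {E J : Type*} (v : J → E → ℂ) (x y : E) :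
    ∑' j, ‖v j x * conj (v j y)‖ₑ ≤ ∑' j, ‖v j x‖ₑ ^ 2 + ∑' j, ‖v j y‖ₑ ^ 2 := by
  rw [← ENNReal.tsum_add]
  refine ENNReal.tsum_le_tsum fun j => ?_
  rw [enorm_mul, RCLike.enorm_conj, sq, sq]
  rcases le_total ‖v j x‖ₑ ‖v j y‖ₑ with h | h
  · exact (mul_le_mul_left h _).trans le_add_self
  · exact (mul_le_mul_right h _).trans le_self_add

theorem hasSum_of_tsum_enorm_ne_top {J : Type*} {a : J → ℂ} (h : ∑' j, ‖a j‖ₑ ≠ ∞) :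
    HasSum a (∑' j, a j) := by
  refine (Summable.of_norm ?_).hasSum
  have := ENNReal.summable_toReal h
  simpa using this

theorem lintegral_prod_add_ne_top {E : Type*} [MeasurableSpace E] {ν : Measure E}
    [IsFiniteMeasure ν] {V : E → ℝ≥0∞} (hV : Measurable V) (hfin : ∫⁻ x, V x ∂ν ≠ ∞) :
    ∫⁻ p : E × E, (V p.1 + V p.2) ∂(ν.prod ν) ≠ ∞ := by
  have hm : Measurable fun p : E × E => V p.1 := hV.comp measurable_fst
  rw [lintegral_add_left hm]
  have h1 : ∫⁻ p : E × E, V p.1 ∂(ν.prod ν) = (∫⁻ x, V x ∂ν) * ν Set.univ := by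
    simpa using lintegral_prod_mul (μ := ν) (ν := ν) hV.aemeasurable
      (g := fun _ => 1) aemeasurable_const
  have h2 : ∫⁻ p : E × E, V p.2 ∂(ν.prod ν) = ν Set.univ * ∫⁻ x, V x ∂ν := by
    simpa using lintegral_prod_mul (μ := ν) (ν := ν) (f := fun _ => 1) aemeasurable_const
      hV.aemeasurable
  rw [h1, h2]
  exact ENNReal.add_ne_top.2 ⟨ENNReal.mul_ne_top hfin (measure_ne_top _ _),
    ENNReal.mul_ne_top (measure_ne_top _ _) hfin⟩

section Kernel

variable {E : Type*} [MeasurableSpace E] {μ : Measure E} {J : Type*} [Countable J]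

/-- The crude bound |ab| ≤ |a|² + |b|² suffices because ν is finite. -/
theorem lintegral_prod_tsum_enorm_ne_top {v : J → E → ℂ} (hv : ∀ j, Measurable (v j))
    {ν : Measure E} [IsFiniteMeasure ν] (hfin : ∫⁻ x, ∑' j, ‖v j x‖ₑ ^ 2 ∂ν ≠ ∞) :
    ∫⁻ p, ∑' j, ‖v j p.1 * conj (v j p.2)‖ₑ ∂(ν.prod ν) ≠ ∞ := by
  have hV : Measurable fun x => ∑' j, ‖v j x‖ₑ ^ 2 :=
    Measurable.tsum fun j => (hv j).enorm.pow_const 2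
  exact ne_top_of_le_ne_top (lintegral_prod_add_ne_top hV hfin)
    (lintegral_mono fun p => tsum_enorm_mul_le v p.1 p.2)

/-- The Gram kernel of the functions `K^{1/2} b j`, integrated over a rectangle. -/
theorem integral_prod_tsum_eq_inner {K R : Lp ℂ 2 μ →L[ℂ] Lp ℂ 2 μ}
    (hR : IsSelfAdjoint R) (hRK : R ∘L R = K) (b : HilbertBasis J ℂ (Lp ℂ 2 μ)) {C s t : Set E}
    (hC : μ C ≠ ∞) (hfin : ∫⁻ x in C, ∑' j, ‖R (b j) x‖ₑ ^ 2 ∂μ ≠ ∞)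
    (hs : MeasurableSet s) (ht : MeasurableSet t) (hsC : s ⊆ C) (htC : t ⊆ C) (hμs : μ s ≠ ∞)
    (hμt : μ t ≠ ∞) :
    ∫ p, ∑' j, R (b j) p.1 * conj (R (b j) p.2) ∂((μ.restrict s).prod (μ.restrict t))
      = inner ℂ (indicatorConstLp 2 hs hμs (1 : ℂ)) (K (indicatorConstLp 2 ht hμt 1)) := by
  have hv : ∀ j, Measurable (R (b j) : E → ℂ) := fun j => (Lp.stronglyMeasurable _).measurable
  have : IsFiniteMeasure (μ.restrict C) := ⟨by rw [Measure.restrict_apply_univ]; exact hC.lt_top⟩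
  have : IsFiniteMeasure (μ.restrict s) := ⟨by rw [Measure.restrict_apply_univ]; exact hμs.lt_top⟩
  have : IsFiniteMeasure (μ.restrict t) := ⟨by rw [Measure.restrict_apply_univ]; exact hμt.lt_top⟩
  have hF : ∀ j, Measurable fun p : E × E => R (b j) p.1 * conj (R (b j) p.2) := fun j =>
    ((hv j).comp measurable_fst).mul
      (Complex.continuous_conj.measurable.comp ((hv j).comp measurable_snd))
  have hle : (μ.restrict s).prod (μ.restrict t) ≤ (μ.restrict C).prod (μ.restrict C) :=
    Measure.prod_mono (Measure.restrict_mono_set μ hsC) (Measure.restrict_mono_set μ htC)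
  have hne := ((lintegral_mono' hle le_rfl).trans_lt
    (lintegral_prod_tsum_enorm_ne_top hv hfin).lt_top).ne
  rw [integral_tsum (fun j => (hF j).aestronglyMeasurable)
    (by rwa [← lintegral_tsum fun j => (hF j).enorm.aemeasurable])]
  have h1 := b.hasSum_inner_mul_inner (R (indicatorConstLp 2 hs hμs (1 : ℂ)))
    (R (indicatorConstLp 2 ht hμt 1))
  have h2 : inner ℂ (R (indicatorConstLp 2 hs hμs (1 : ℂ))) (R (indicatorConstLp 2 ht hμt 1))
      = inner ℂ (indicatorConstLp 2 hs hμs (1 : ℂ)) (K (indicatorConstLp 2 ht hμt 1)) := by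
    rw [hR.inner_map_eq, ← hRK]; rfl
  rw [← h2, ← h1.tsum_eq]
  refine tsum_congr fun j => ?_
  rw [integral_prod_mul (fun x => R (b j) x) (fun y => conj (R (b j) y)), hR.inner_map_eq,
    L2.inner_indicatorConstLp_one, ← hR.inner_map_eq, ← inner_conj_symm,
    L2.inner_indicatorConstLp_one, integral_conj]

variable [TopologicalSpace E]

theorem IsKernel.integral_prod_eq_inner [T2Space E] [OpensMeasurableSpace E]
    {K : Lp ℂ 2 μ →L[ℂ] Lp ℂ 2 μ} {k : E → E → ℂ} (hk : IsKernel μ K k) {C s t : Set E}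
    (hC : IsCompact C)
    (hint : IntegrableOn (fun p : E × E => k p.1 p.2) (C ×ˢ C) (μ.prod μ))
    (hs : MeasurableSet s) (ht : MeasurableSet t) (hsC : s ⊆ C) (htC : t ⊆ C) (hμs : μ s ≠ ∞)
    (hμt : μ t ≠ ∞) [SFinite μ] :
    ∫ p, k p.1 p.2 ∂((μ.restrict s).prod (μ.restrict t))
      = inner ℂ (indicatorConstLp 2 hs hμs (1 : ℂ)) (K (indicatorConstLp 2 ht hμt 1)) := by
  have hi : Integrable (fun p : E × E => k p.1 p.2) ((μ.restrict s).prod (μ.restrict t)) := by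
    rw [Measure.prod_restrict]
    exact hint.mono_set (Set.prod_mono hsC htC)
  rw [integral_prod _ hi, L2.inner_indicatorConstLp_one]
  refine integral_congr_ae (ae_restrict_of_ae ?_)
  have hzero : ∀ᵐ x ∂μ, x ∉ C → (indicatorConstLp 2 ht hμt (1 : ℂ) : E → ℂ) x = 0 := by
    filter_upwards [indicatorConstLp_coeFn (p := 2) (hs := ht) (hμs := hμt) (c := (1 : ℂ))] with x hx hxC
    rw [hx, Set.indicator_of_notMem fun h => hxC (htC h)]
  filter_upwards [hk.apply_eq C hC _ hzero] with x hx
  rw [hx, ← integral_indicator ht]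
  refine integral_congr_ae ?_
  filter_upwards [indicatorConstLp_coeFn (p := 2) (hs := ht) (hμs := hμt) (c := (1 : ℂ))] with y hy
  rw [hy]
  by_cases h : y ∈ t <;> simp [h]

/-- Over a rectangle s × t inside C × C, both kernels integrate to ⟨1_s, K 1_t⟩, and rectangles
determine an integrable function. Square integrability of `k` gives integrability because C has
finite measure. -/
theorem IsKernel.ae_hasSum_restrict [T2Space E] [OpensMeasurableSpace E] [SFinite μ]
    [IsFiniteMeasureOnCompacts μ]
    {K R : Lp ℂ 2 μ →L[ℂ] Lp ℂ 2 μ} {k : E → E → ℂ} (hk : IsKernel μ K k)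
    (hR : IsSelfAdjoint R) (hRK : R ∘L R = K) (b : HilbertBasis J ℂ (Lp ℂ 2 μ)) {C : Set E}
    (hC : IsCompact C) (hfin : ∫⁻ x in C, ∑' j, ‖R (b j) x‖ₑ ^ 2 ∂μ ≠ ∞) :
    ∀ᵐ p ∂((μ.restrict C).prod (μ.restrict C)),
      HasSum (fun j => R (b j) p.1 * conj (R (b j) p.2)) (k p.1 p.2) := by
  have hCm := hC.measurableSet
  have hμC : μ C ≠ ∞ := hC.measure_lt_top.ne
  have hv : ∀ j, Measurable (R (b j) : E → ℂ) := fun j => (Lp.stronglyMeasurable _).measurable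
  have : IsFiniteMeasure (μ.restrict C) := ⟨by rw [Measure.restrict_apply_univ]; exact hμC.lt_top⟩
  have hF : ∀ j, Measurable fun p : E × E => R (b j) p.1 * conj (R (b j) p.2) := fun j =>
    ((hv j).comp measurable_fst).mul
      (Complex.continuous_conj.measurable.comp ((hv j).comp measurable_snd))
  have hne := lintegral_prod_tsum_enorm_ne_top hv hfin
  have hsum : ∀ᵐ p ∂((μ.restrict C).prod (μ.restrict C)),
      HasSum (fun j => R (b j) p.1 * conj (R (b j) p.2))
        (∑' j, R (b j) p.1 * conj (R (b j) p.2)) := by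
    filter_upwards [ae_lt_top (Measurable.tsum fun j => (hF j).enorm) hne] with p hp
    exact hasSum_of_tsum_enorm_ne_top hp.ne
  have hgi : Integrable (fun p : E × E => ∑' j, R (b j) p.1 * conj (R (b j) p.2))
      ((μ.restrict C).prod (μ.restrict C)) := by
    refine ⟨(Measurable.tsum hF).aestronglyMeasurable, ?_⟩
    refine (lintegral_mono fun p => enorm_tsum_le_tsum_enorm).trans_lt hne.lt_top
  have hkm : Measurable fun p : E × E => k p.1 p.2 := hk.measurable
  have hki : Integrable (fun p : E × E => k p.1 p.2) ((μ.restrict C).prod (μ.restrict C)) := by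
    have h2 := hk.sq_integrable C hC
    rw [IntegrableOn, ← Measure.prod_restrict] at h2
    exact ((memLp_two_iff_integrable_sq_norm hkm.aestronglyMeasurable).2 h2).integrable (by simp)
  have hae : (fun p : E × E => k p.1 p.2)
      =ᵐ[(μ.restrict C).prod (μ.restrict C)] fun p => ∑' j, R (b j) p.1 * conj (R (b j) p.2) := by
    refine ae_eq_of_forall_setIntegral_prod_eq hki hgi fun s t hs ht => ?_
    have hsC : μ (s ∩ C) ≠ ∞ := measure_ne_top_of_subset Set.inter_subset_right hμC
    have htC : μ (t ∩ C) ≠ ∞ := measure_ne_top_of_subset Set.inter_subset_right hμC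
    rw [← Measure.prod_restrict, Measure.restrict_restrict hs, Measure.restrict_restrict ht,
      hk.integral_prod_eq_inner hC (by rwa [IntegrableOn, ← Measure.prod_restrict])
        (hs.inter hCm) (ht.inter hCm) Set.inter_subset_right Set.inter_subset_right hsC htC,
      integral_prod_tsum_eq_inner hR hRK b hμC hfin
        (hs.inter hCm) (ht.inter hCm) Set.inter_subset_right Set.inter_subset_right hsC htC]
  filter_upwards [hsum, hae] with p h1 h2
  rwa [h2]

/-- Closed sets form a generating π-system and meet a compact set in a compact set. This gives
equality on each member of a compact exhaustion. -/
theorem ae_eq_of_forall_compact_setLIntegral_eq [SigmaCompactSpace E] [T2Space E] [BorelSpace E]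
    {f g : E → ℝ≥0∞} (hf : Measurable f) (hg : Measurable g)
    (hfin : ∀ C, IsCompact C → ∫⁻ x in C, f x ∂μ ≠ ∞)
    (h : ∀ C, IsCompact C → ∫⁻ x in C, f x ∂μ = ∫⁻ x in C, g x ∂μ) : f =ᵐ[μ] g := by
  have hcov : ∀ᵐ x ∂(μ.restrict (⋃ n, compactCovering E n)), f x = g x := by
    rw [ae_restrict_iUnion_iff]
    intro n
    have hC := isCompact_compactCovering E n
    set C := compactCovering E n
    have h1 : ∫⁻ x in C, f x ∂μ ≠ ∞ := hfin C hC
    refine (withDensity_eq_iff hf.aemeasurable hg.aemeasurable h1).1 ?_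
    have : IsFiniteMeasure ((μ.restrict C).withDensity f) := isFiniteMeasure_withDensity h1
    refine ext_of_generate_finite {s | IsClosed s}
      (by rw [BorelSpace.measurable_eq (α := E), borel_eq_generateFrom_isClosed]) isPiSystem_isClosed
      (fun s hs => ?_) ?_
    · have hsm : MeasurableSet s := IsClosed.measurableSet hs
      rw [withDensity_apply _ hsm, withDensity_apply _ hsm, Measure.restrict_restrict hsm]
      exact h _ (hC.inter_left hs)
    · rw [withDensity_apply _ MeasurableSet.univ, withDensity_apply _ MeasurableSet.univ,
        Measure.restrict_univ]
      exact h C hC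
  rwa [iUnion_compactCovering, Measure.restrict_univ] at hcov

/-- Off the diagonal the operator determines the kernel. On the diagonal the trace normalization is
needed: k(x, x) and ∑_j |R b_j(x)|² have the same integral over every compact set. -/
theorem IsKernel.isGram [T2Space E] [SigmaCompactSpace E] [BorelSpace E] [SigmaFinite μ]
    [IsFiniteMeasureOnCompacts μ]
    {K R : Lp ℂ 2 μ →L[ℂ] Lp ℂ 2 μ} {k : E → E → ℂ} (hk : IsKernel μ K k)
    (hR : IsSelfAdjoint R) (hRK : R ∘L R = K) (b : HilbertBasis J ℂ (Lp ℂ 2 μ))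
    (hfin : ∀ C, IsCompact C → ∫⁻ x in C, ∑' j, ‖R (b j) x‖ₑ ^ 2 ∂μ ≠ ∞) :
    IsGram μ k fun j => (R (b j) : E → ℂ) := by
  have hv : ∀ j, Measurable (R (b j) : E → ℂ) := fun j => (Lp.stronglyMeasurable _).measurable
  refine ⟨hv, ?_, ?_⟩
  · have hU : (⋃ n, compactCovering E n ×ˢ compactCovering E n) = (Set.univ : Set (E × E)) := by
      rw [Set.eq_univ_iff_forall]
      rintro ⟨x, y⟩
      obtain ⟨n, hn⟩ := exists_mem_compactCovering x
      obtain ⟨m, hm⟩ := exists_mem_compactCovering y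
      exact Set.mem_iUnion.2 ⟨max n m, compactCovering_subset E (le_max_left _ _) hn,
        compactCovering_subset E (le_max_right _ _) hm⟩
    rw [← Measure.restrict_univ (μ := μ.prod μ), ← hU, ae_restrict_iUnion_iff]
    intro n
    have hC := isCompact_compactCovering E n
    rw [← Measure.prod_restrict]
    exact hk.ae_hasSum_restrict hR hRK b hC (hfin _ hC)
  · have hV : Measurable fun x => ∑' j, ‖R (b j) x‖ₑ ^ 2 :=
      Measurable.tsum fun j => (hv j).enorm.pow_const 2
    have hkd : Measurable fun x => ENNReal.ofReal (k x x).re :=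
      ENNReal.measurable_ofReal.comp (Complex.measurable_re.comp
        (hk.measurable.comp (measurable_id.prodMk measurable_id)))
    obtain ⟨w, b', -⟩ := exists_hilbertBasis ℂ (Lp ℂ 2 μ)
    have hae := ae_eq_of_forall_compact_setLIntegral_eq hV hkd hfin fun C hC => by
      rw [hk.diagonal C hC.measurableSet hC w b', lintegral_tsum_eq_traceAlong hR hRK b b']
    filter_upwards [hae] with x hx
    have hpos : 0 ≤ k x x := (hk.posSemidef 1 fun _ => x).diag_nonneg (i := 0)
    have hre : k x x = ((k x x).re : ℂ) :=
      Complex.ext rfl (by simpa using (Complex.le_def.1 hpos).2.symm)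
    have hre0 : 0 ≤ (k x x).re := (Complex.le_def.1 hpos).1
    have hne : ∑' j, ‖R (b j) x‖ₑ ^ 2 ≠ ∞ := by rw [hx]; exact ENNReal.ofReal_ne_top
    have h1 := (ENNReal.summable_toReal hne).hasSum
    rw [← ENNReal.tsum_toReal_eq (fun j => ENNReal.ne_top_of_tsum_ne_top hne j), hx,
      ENNReal.toReal_ofReal hre0] at h1
    rw [hre]
    have h2 := Complex.hasSum_ofReal.2 h1
    convert! h2 using 2 with j
    rw [Complex.mul_conj']
    simp

end Kernel

/-! ### The adapted basis and the transported operator. -/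

/-- A countable Hilbert basis of `L²(E, μ)` adapted to a partition: each basis vector vanishes
outside one of the sets. -/
theorem exists_adapted_hilbertBasis {E : Type*} [MeasurableSpace E] {μ : Measure E}
    [TopologicalSpace.SeparableSpace (Lp ℂ 2 μ)] {A : ℕ → Set E} (hA : IsPartition A)
    (hAm : ∀ i, MeasurableSet (A i)) :
    ∃ (F : Type) (_ : Countable F) (b : HilbertBasis F ℂ (Lp ℂ 2 μ)) (κ : F → ℕ),
      ∀ i y, restrictL μ (hAm i) (b y) = if κ y = i then b y else 0 := by
  -- The functions vanishing outside `A i`, written as a kernel so that closedness is immediate.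
  let V : ℕ → Submodule ℂ (Lp ℂ 2 μ) := fun i =>
    LinearMap.ker ((ContinuousLinearMap.id ℂ (Lp ℂ 2 μ) - restrictL μ (hAm i) :
      Lp ℂ 2 μ →L[ℂ] Lp ℂ 2 μ) : Lp ℂ 2 μ →ₗ[ℂ] Lp ℂ 2 μ)
  have hmem : ∀ i f, f ∈ V i ↔ restrictL μ (hAm i) f = f := by
    intro i f
    simp only [V, LinearMap.mem_ker, ContinuousLinearMap.coe_coe, _root_.sub_apply,
      ContinuousLinearMap.id_apply, sub_eq_zero]
    exact eq_comm
  have hclosed : ∀ i, IsClosed (V i : Set (Lp ℂ 2 μ)) := fun i =>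
    ContinuousLinearMap.isClosed_ker _
  have hcomplete : ∀ i, CompleteSpace (V i) := fun i => (hclosed i).completeSpace_coe
  choose w b hb using fun i => exists_hilbertBasis ℂ (V i)
  have hres : ∀ i j (f : V j), restrictL μ (hAm i) (f : Lp ℂ 2 μ)
      = if j = i then (f : Lp ℂ 2 μ) else 0 := by
    intro i j f
    split_ifs with h
    · subst h
      exact (hmem j f).1 f.2
    · rw [← (hmem j f).1 f.2, restrictL_comp_restrictL,
        restrictL_eq_zero_of_eq_empty _ (hA.1 (Ne.symm h)).inter_eq]
  let v : (Σ i, w i) → Lp ℂ 2 μ := fun y => (b y.1 y.2 : V y.1)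
  have hvres : ∀ i y, restrictL μ (hAm i) (v y) = if y.1 = i then v y else 0 :=
    fun i y => hres i y.1 _
  have hv : Orthonormal ℂ v := by
    refine ⟨fun y => ?_, ?_⟩
    · exact (b y.1).orthonormal.1 y.2
    · rintro ⟨i, y⟩ ⟨j, y'⟩ hne
      by_cases hij : i = j
      · subst hij
        have hne' : y ≠ y' := fun h => hne (by rw [h])
        exact (b i).orthonormal.2 hne'
      · have h1 := hvres i ⟨i, y⟩
        rw [if_pos rfl] at h1
        rw [← h1, (isSelfAdjoint_restrictL (hAm i)).inner_map_eq, hvres i ⟨j, y'⟩,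
          if_neg (Ne.symm hij), inner_zero_right]
  have hcount : Countable (Σ i, w i) := countable_of_orthonormal hv
  -- Countability allows the index set to be moved to `Type`, whatever the universe of E.
  let e := equivShrink.{0} (Σ i, w i)
  have hv' : Orthonormal ℂ (v ∘ e.symm) := hv.comp _ e.symm.injective
  have hspan : (Submodule.span ℂ (Set.range (v ∘ e.symm)))ᗮ = ⊥ := by
    rw [Submodule.eq_bot_iff]
    intro f hf
    have hperp : ∀ y, inner ℂ (v y) f = 0 := fun y =>
      (Submodule.mem_orthogonal _ _).1 hf _ (Submodule.subset_span ⟨e y, by simp⟩)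
    -- The restriction of f to `A i` lies in `V i` and is orthogonal to its basis. Since the cells
    -- cover E, f itself vanishes.
    have hzero : ∀ i, restrictL μ (hAm i) f = 0 := by
      intro i
      have hVi : restrictL μ (hAm i) f ∈ V i := by
        rw [hmem, restrictL_comp_restrictL]
        congr 2
        exact Set.inter_self _
      have h0 : (⟨_, hVi⟩ : V i) = 0 := by
        refine (b i).repr.injective ?_
        ext y
        rw [map_zero, HilbertBasis.repr_apply_apply]
        change inner ℂ (v ⟨i, y⟩) (restrictL μ (hAm i) f) = 0
        rw [← (isSelfAdjoint_restrictL (hAm i)).inner_map_eq, hvres i ⟨i, y⟩, if_pos rfl]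
        exact hperp _
      exact congrArg Subtype.val h0
    ext1
    have hall : ∀ᵐ x ∂μ, ∀ i, (A i).indicator f x = 0 := by
      rw [ae_all_iff]
      intro i
      have := coeFn_restrictL (hAm i) f
      rw [hzero i] at this
      filter_upwards [this, Lp.coeFn_zero ℂ 2 μ] with x h1 h2
      rw [← h1, h2]
      rfl
    filter_upwards [hall, Lp.coeFn_zero ℂ 2 μ] with x h1 h2
    obtain ⟨i, hi⟩ := Set.mem_iUnion.1 (hA.2 ▸ Set.mem_univ x : x ∈ ⋃ i, A i)
    rw [h2, Pi.zero_apply, ← h1 i, Set.indicator_of_mem hi]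
  refine ⟨Shrink.{0} (Σ i, w i), e.symm.injective.countable,
    HilbertBasis.mkOfOrthogonalEqBot hv' hspan, fun y => (e.symm y).1, fun i y => ?_⟩
  rw [HilbertBasis.coe_mkOfOrthogonalEqBot]
  exact hvres i _

/-- The operator `K`, transported to `ℓ²(F)` by a Hilbert basis. -/
noncomputable def transport {H F : Type*} [NormedAddCommGroup H] [InnerProductSpace ℂ H]
    (b : HilbertBasis F ℂ H) (K : H →L[ℂ] H) : Ell2 F →L[ℂ] Ell2 F :=
  (b.repr.toContinuousLinearEquiv : H →L[ℂ] Ell2 F) ∘L K ∘L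
    (b.repr.symm.toContinuousLinearEquiv : Ell2 F →L[ℂ] H)

theorem transport_apply {H F : Type*} [NormedAddCommGroup H] [InnerProductSpace ℂ H]
    (b : HilbertBasis F ℂ H) (K : H →L[ℂ] H) (f : Ell2 F) :
    transport b K f = b.repr (K (b.repr.symm f)) := rfl

theorem matrixEntry_transport {H F : Type*} [NormedAddCommGroup H] [InnerProductSpace ℂ H]
    (b : HilbertBasis F ℂ H) (K : H →L[ℂ] H) (x y : F) :
    matrixEntry (transport b K) x y = inner ℂ (b x) (K (b y)) := by
  classical
  rw [matrixEntry, transport_apply, HilbertBasis.repr_apply_apply]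
  congr 3

section Transport

variable {H F : Type*} [NormedAddCommGroup H] [InnerProductSpace ℂ H] [CompleteSpace H]

theorem isPositiveContraction_transport (b : HilbertBasis F ℂ H) {K : H →L[ℂ] H}
    (hK : IsPositiveContraction K) : IsPositiveContraction (transport b K) := by
  have hinner : ∀ f g : Ell2 F, inner ℂ (transport b K f) g
      = inner ℂ (K (b.repr.symm f)) (b.repr.symm g) := by
    intro f g
    rw [transport_apply, ← b.repr.symm.inner_map_map, LinearIsometryEquiv.symm_apply_apply]
  constructor
  · rw [ContinuousLinearMap.isPositive_iff_complex]
    intro f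
    rw [hinner]
    exact (ContinuousLinearMap.isPositive_iff_complex K).1 hK.1 _
  · refine ContinuousLinearMap.opNorm_le_bound _ zero_le_one fun f => ?_
    rw [transport_apply, LinearIsometryEquiv.norm_map, one_mul]
    calc ‖K (b.repr.symm f)‖ ≤ ‖K‖ * ‖b.repr.symm f‖ := K.le_opNorm _
      _ ≤ 1 * ‖b.repr.symm f‖ := by gcongr; exact hK.2
      _ = ‖f‖ := by rw [one_mul, LinearIsometryEquiv.norm_map]

/-- With K = R² this is the Gram matrix of the vectors R u_i. It is applied to both K and 1 - K. -/
theorem posSemidef_matrix_of_isPositive {K : H →L[ℂ] H} (hK : K.IsPositive) {I : Type*} [Fintype I]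
    (u : I → H) : (Matrix.of fun i j => inner ℂ (u i) (K (u j))).PosSemidef := by
  obtain ⟨R, hR, rfl⟩ := exists_isSelfAdjoint_comp_self_eq hK
  have : (Matrix.of fun i j => inner ℂ (u i) ((R ∘L R) (u j))) = Matrix.gram ℂ fun i => R (u i) := by
    ext i j
    rw [Matrix.of_apply, Matrix.gram_apply, hR.inner_map_eq]
    rfl
  rw [this]
  exact Matrix.posSemidef_gram ℂ _

theorem IsPositiveContraction.isPositive_one_sub {K : H →L[ℂ] H} (hK : IsPositiveContraction K) :
    (1 - K).IsPositive := by
  rw [← ContinuousLinearMap.nonneg_iff_isPositive, sub_nonneg]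
  have h0 := (ContinuousLinearMap.nonneg_iff_isPositive K).2 hK.1
  exact (CStarAlgebra.norm_le_one_iff_of_nonneg K h0).1 hK.2

theorem exists_isDiscreteDeterminantalLaw_transport [Countable F] [TopologicalSpace F]
    [DiscreteTopology F] [MeasurableSpace F] [BorelSpace F] (b : HilbertBasis F ℂ H)
    {K : H →L[ℂ] H} (hK : IsPositiveContraction K) :
    ∃ P : Measure (Config F), IsDiscreteDeterminantalLaw (transport b K) P := by
  refine exists_isDeterminantalWith_count _ (fun s => ?_) fun s _ => ?_
  · simp_rw [matrixEntry_transport]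
    exact posSemidef_matrix_of_isPositive hK.1 fun x : s => b x
  · have h : ((1 : Matrix s s ℂ) - Matrix.of fun x y : s => matrixEntry (transport b K) x y)
        = Matrix.of fun x y : s => inner ℂ (b x) ((1 - K) (b y)) := by
      ext x y
      have := orthonormal_iff_ite.1 (b.orthonormal.comp (fun x : s => x.1) Subtype.val_injective) x y
      simp only [Function.comp_apply] at this
      simp only [Matrix.sub_apply, Matrix.of_apply, matrixEntry_transport,
        _root_.sub_apply, one_apply_eq_self, inner_sub_right, this,
        Matrix.one_apply]
    rw [h]
    exact posSemidef_matrix_of_isPositive hK.isPositive_one_sub fun x : s => b x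

/-- Parseval applied to ⟨R b_x, R b_y⟩. The functions on F are the coordinate sequences of the
vectors R b_j, the same vectors that give the kernel on E. -/
theorem isGram_matrixEntry_transport [Countable F] [MeasurableSpace F] [MeasurableSingletonClass F]
    (b : HilbertBasis F ℂ H) {K R : H →L[ℂ] H} (hR : IsSelfAdjoint R) (hRK : R ∘L R = K) :
    IsGram Measure.count (matrixEntry (transport b K)) fun j y => inner ℂ (b y) (R (b j)) := by
  have h : ∀ x y, HasSum (fun j => inner ℂ (b x) (R (b j)) * conj (inner ℂ (b y) (R (b j))))
      (matrixEntry (transport b K) x y) := by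
    intro x y
    rw [matrixEntry_transport, ← hRK]
    have h1 := b.hasSum_inner_mul_inner (R (b x)) (R (b y))
    rw [hR.inner_map_eq] at h1
    convert! h1 using 2 with j
    rw [inner_conj_symm, hR.inner_map_eq, hR.inner_map_eq]
  exact ⟨fun j => measurable_of_countable _, Filter.Eventually.of_forall fun p => h _ _,
    Filter.Eventually.of_forall fun x => h _ _⟩

end Transport

/-! ### Gram numbers on the discrete side. -/

theorem inner_projection_eq {H F : Type*} [NormedAddCommGroup H] [InnerProductSpace ℂ H]
    [CompleteSpace H] {b : HilbertBasis F ℂ H} {p : H →L[ℂ] H} {B : Set F} (hp : IsSelfAdjoint p)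
    [DecidablePred (· ∈ B)]
    (hpb : ∀ y, p (b y) = if y ∈ B then b y else 0)
    (f : H) (y : F) : inner ℂ (b y) (p f) = if y ∈ B then inner ℂ (b y) f else 0 := by
  rw [← hp.inner_map_eq, hpb]
  split_ifs <;> simp

section DiscreteGram

variable {H F : Type*} [NormedAddCommGroup H] [InnerProductSpace ℂ H] [CompleteSpace H]
  [Countable F] [MeasurableSpace F] [MeasurableSingletonClass F] {b : HilbertBasis F ℂ H}
  {p : H →L[ℂ] H} {B : Set F}

theorem lintegral_count_enorm_inner_sq (hp : IsSelfAdjoint p) [DecidablePred (· ∈ B)]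
    (hpb : ∀ y, p (b y) = if y ∈ B then b y else 0) (f : H) :
    ∫⁻ y in B, ‖inner ℂ (b y) f‖ₑ ^ 2 ∂Measure.count = ‖p f‖ₑ ^ 2 := by
  rw [← lintegral_indicator (Set.to_countable B).measurableSet, lintegral_count,
    ← b.tsum_enorm_inner_sq]
  refine tsum_congr fun y => ?_
  rw [inner_projection_eq hp hpb, Set.indicator_apply]
  split_ifs <;> simp

/-- In the basis `b`, the projection `p` keeps exactly the coordinates in `B`, so this is Parseval
for ⟨g, p f⟩. -/
theorem integral_count_inner_mul_inner (hp : IsSelfAdjoint p) [DecidablePred (· ∈ B)]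
    (hpb : ∀ y, p (b y) = if y ∈ B then b y else 0) (f g : H) :
    ∫ y in B, inner ℂ (b y) f * conj (inner ℂ (b y) g) ∂Measure.count = inner ℂ g (p f) := by
  have h := b.hasSum_inner_mul_inner g (p f)
  rw [← integral_indicator (Set.to_countable B).measurableSet]
  have heq : B.indicator (fun y => inner ℂ (b y) f * conj (inner ℂ (b y) g))
      = fun y => inner ℂ g (b y) * inner ℂ (b y) (p f) := by
    ext y
    rw [inner_projection_eq hp hpb, Set.indicator_apply, inner_conj_symm]
    split_ifs <;> simp [mul_comm]
  rw [heq, integral_countable, ← h.tsum_eq]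
  · simp
  · rw [integrable_count_iff]
    exact h.summable.norm

end DiscreteGram

end DPP

/-! ### Proof of the theorem. -/

open DPP

theorem theorem1 {E : Type*} [TopologicalSpace E] [PolishSpace E] [LocallyCompactSpace E]
    [MeasurableSpace E] [BorelSpace E]
    (μ : Measure E) [IsFiniteMeasureOnCompacts μ]
    (K : Lp ℂ 2 μ →L[ℂ] Lp ℂ 2 μ)
    (hK : DPP.IsPositiveContraction K) (hK' : DPP.IsLocallyTraceClass μ K)
    (A : ℕ → Set E) (hA : DPP.IsPartition A)
    (hA_meas : ∀ i, MeasurableSet (A i)) (hA_compact : ∀ i, IsCompact (closure (A i))) :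
    ∃ (F : Type) (_ : Countable F) (_ : TopologicalSpace F) (_ : DiscreteTopology F)
      (_ : MeasurableSpace F) (_ : BorelSpace F)
      (B : ℕ → Set F) (Q : DPP.Ell2 F →L[ℂ] DPP.Ell2 F),
      DPP.IsPartition B ∧
      DPP.IsPositiveContraction Q ∧
      (∃ U : Lp ℂ 2 μ ≃ₗᵢ[ℂ] DPP.Ell2 F, ∀ f, U (K f) = Q (U f)) ∧
      (∃ P' : Measure (DPP.Config F), DPP.IsDiscreteDeterminantalLaw Q P') ∧
      ∀ (P : Measure (DPP.Config E)) (P' : Measure (DPP.Config F)),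
        DPP.IsDeterminantalLaw μ K P → DPP.IsDiscreteDeterminantalLaw Q P' →
          DPP.jointCountLaw P A = DPP.jointCountLaw P' B := by
  have : Fact ((2 : ℝ≥0∞) ≠ ∞) := ⟨by simp⟩
  have : TopologicalSpace.SeparableSpace (Lp ℂ 2 μ) := inferInstance
  obtain ⟨F, hF, b, κ, hκ⟩ := exists_adapted_hilbertBasis (μ := μ) hA hA_meas
  obtain ⟨R, hR, hRK⟩ := exists_isSelfAdjoint_comp_self_eq hK.1
  let τF : TopologicalSpace F := ⊥
  have : DiscreteTopology F := ⟨rfl⟩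
  let mF : MeasurableSpace F := borel F
  have : BorelSpace F := ⟨rfl⟩
  let B : ℕ → Set F := fun i => {y | κ y = i}
  have hB : Pairwise fun i j => Disjoint (B i) (B j) := fun i j hij =>
    Set.disjoint_left.2 fun y hy hy' => hij (Eq.trans (Eq.symm hy) hy')
  have hBm : ∀ i, MeasurableSet (B i) := fun i => (Set.to_countable _).measurableSet
  refine ⟨F, hF, τF, inferInstance, mF, inferInstance, B, transport b K,
    ⟨hB, Set.eq_univ_iff_forall.2 fun y => Set.mem_iUnion.2 ⟨κ y, rfl⟩⟩,
    isPositiveContraction_transport b hK, ⟨b.repr, fun f => ?_⟩,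
    exists_isDiscreteDeterminantalLaw_transport b hK, ?_⟩
  · rw [transport_apply, LinearIsometryEquiv.symm_apply_apply]
  · rintro P P' ⟨k, hk, hP⟩ hP'
    -- The trace-class condition speaks of bases indexed by sets of vectors, hence this auxiliary
    -- basis.
    obtain ⟨w, b', -⟩ := exists_hilbertBasis ℂ (Lp ℂ 2 μ)
    have hfinC : ∀ C, IsCompact C → ∫⁻ x in C, ∑' j, ‖R (b j) x‖ₑ ^ 2 ∂μ ≠ ∞ := fun C hC => by
      rw [lintegral_tsum_eq_traceAlong hR hRK b b' hC.measurableSet]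
      exact (hK' C hC.measurableSet hC).2 w b'
    have hfin : ∀ i, ∫⁻ x in A i, ∑' j, ‖R (b j) x‖ₑ ^ 2 ∂μ ≠ ∞ := fun i =>
      ne_top_of_le_ne_top (hfinC _ (hA_compact i)) (lintegral_mono_set subset_closure)
    have hself : ∀ i, IsSelfAdjoint (restrictL μ (hA_meas i)) := fun i =>
      isSelfAdjoint_restrictL (hA_meas i)
    have hpb : ∀ i y, restrictL μ (hA_meas i) (b y) = if y ∈ B i then b y else 0 := hκ
    have hfin' : ∀ i, ∫⁻ y in B i, ∑' j, ‖inner ℂ (b y) (R (b j))‖ₑ ^ 2 ∂Measure.count ≠ ∞ := by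
      intro i
      rw [lintegral_tsum fun j => (measurable_of_countable _).aemeasurable]
      simp_rw [lintegral_count_enorm_inner_sq (hself i) (hpb i), enorm_restrictL_sq]
      rw [← lintegral_tsum
        fun j => ((Lp.stronglyMeasurable _).measurable.enorm.pow_const 2).aemeasurable]
      exact hfin i
    refine (hk.isGram hR hRK b hfinC).jointCountLaw_eq (isGram_matrixEntry_transport b hR hRK)
      hP hP' hA.1 hB hA_meas hBm hfin hfin' fun i j l => ?_
    -- Both Gram numbers are ⟨R b_l, 1_{A_i} R b_j⟩.
    rw [integral_count_inner_mul_inner (hself i) (hpb i), inner_restrictL]
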